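/- **Setting.** Let $H$ be a real separable Hilbert space with norm $\|\cdot\|_H$, $a(\cdot,\cdot)$ a symmetric, bounded and coercive bilinear form on $H$, and $b(\cdot,\cdot)$ a second inner product on $H$ whose norm is compact with respect to $\|\cdot\|_H$. Write $\|v\|=\sqrt{a(v,v)}$. For subspaces $U,V\subset H$ with $U\neq\{0\}$ put $\operatorname{dist}(U,V)=\sup_{u\in U,\|u\|=1}\inf_{v\in V}\|u-v\|$, and for vectors $\operatorname{dist}(u,v)=\operatorname{dist}(\operatorname{span}\{u\},\operatorname{span}\{v\})$. Let $\lambda_1<\dots<\lambda_q$ ($q\ge1$) be the $q$ smallest eigenvalues of $a(u,v)=\lambda b(u,v)\ \forall v\in H$, with multiplicities $d_1,\dots,d_q$; put $N=\sum_{i=1}^q d_i$ and $D=\max_{1\le i\le q} d_i$. Let $V^h\subset H$ be a subspace with $N<\dim V^h<\infty$, and let $(\lambda^h_k,u^h_k)$, $1\le k\le\dim V^h$, be the eigenpairs of $a(u,v)=\lambda b(u,v)\ \forall v\in V^h$, in nondecreasing order of the eigenvalues, with $b(u^h_k,u^h_l)=\delta_{kl}$. For $i\le q$, $j\le d_i$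 the double index $(i,j)$ stands for $k=d_1+\dots+d_{i-1}+j$, and $(q+1,1)$ stands for $k=N+1$. Let $M_h(\lambda_i)=\operatorname{span}\{u^h_{i1},\dots,u^h_{id_i}\}$, $$g=\min_{1\le i<r\le q+1}|\lambda^h_{id_i}-\lambda^h_{r1}|,\qquad \gamma=\max_{1\le i\le q}(\lambda^h_{id_i}-\lambda^h_{i1}).$$ By "orthonormal bases of the $M_h(\lambda_i)$" we mean vectors $u^{h,o}_{ij}$ such that $\{u^{h,o}_{ij}\}_{j=1}^{d_i}$ spans $M_h(\lambda_i)$ for every $i\le q$ and $b(u^{h,o}_{ij},u^{h,o}_{kl})=\delta_{ik}\delta_{jl}$. **Algorithm** (shifted-inverse ParO). Fix for each $i\le q$ a convex combination $\mathcal C_i(\{x_j\}_{j=1}^{d_i})=\sum_j w_{ij}x_j$, $w_{ij}\ge 0$, $\sum_j w_{ij}=1$. Start from $(\lambda^{(0)}_{ij},u^{(0)}_{ij})\in\mathbb R\times V^h$. Iteration $n\ge0$: put $\bar\lambda^{(n)}_i=\mathcal C_i(\{\lambda^{(n)}_{ij}\}_{j})$, find $u^{(n+1/2)}_{ij}\in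 V^h$ with $$a(u^{(n+1/2)}_{ij},v)-\bar\lambda^{(n)}_i b(u^{(n+1/2)}_{ij},v)=\bar\lambda^{(n)}_i b(u^{(n)}_{ij},v)\quad\forall v\in V^h,$$ and let $(\lambda^{(n+1)}_{ij},u^{(n+1)}_{ij})$ be the $N$ eigenpairs, in nondecreasing order of the eigenvalues and with $b(u^{(n+1)}_{ij},u^{(n+1)}_{kl})=\delta_{ik}\delta_{jl}$, of $a(u,v)=\lambda b(u,v)\ \forall v\in U_{n+1}$ in $U_{n+1}=\operatorname{span}\{u^{(n+1/2)}_{ij}\}$. It is assumed that the shifts are never equal to an eigenvalue $\lambda^h_k$. **Theorem.** Let $q\ge 1$, $d_1,\dots,d_q\ge1$ and $\kappa>0$. There is a constant $C_0>0$ depending only on $q,d_1,\dots,d_q,\kappa$ such that for every $\tilde C_{**}\ge C_0$ there is $c>0$, depending only on $q,d_1,\dots,d_q,\kappa,\tilde C_{**}$, for which the following holds for every setting as above with $g\ge\kappa\lambda^h_{q+1,1}$ and $\lambda^h_{11}\ge\kappa\lambda^h_{q+1,1}$. 1. ($\tilde C_{**}$ is a constant for the projected eigenvalue problem.) Let $U\subset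 V^h$ with $\dim U=N$ and $\operatorname{dist}(\bigoplus_{i=1}^q M_h(\lambda_i),U)\le c$, and let $(\mu_{ij},u_{ij})$ be the $b$-orthonormal eigenpairs, in nondecreasing order, of $a(u,v)=\mu b(u,v)\ \forall v\in U$ in $U$. Then there are orthonormal bases $\{u^{h,o}_{ij}\}$ of the $M_h(\lambda_i)$ with $\operatorname{dist}(u^{h,o}_{ij},u_{ij})\le\tilde C_{**}\operatorname{dist}(\bigoplus_{i=1}^q M_h(\lambda_i),U)$ for all $(i,j)\le(q,d_q)$. 2. Assume that $0<\varepsilon_0\le c$, that there are orthonormal bases $\{u^{h,o,0}_{ij}\}$ of the $M_h(\lambda_i)$ with $\operatorname{dist}(u^{h,o,0}_{ij},u^{(0)}_{ij})\le\varepsilon_0$ for all $(i,j)\le(q,d_q)$, and that $$\zeta_0:=\max_{1\le i\le q}\bigl|\mathcal C_i(\{\lambda^h_{ij}\}_j)-\bar\lambda^{(0)}_i\bigr|\le c\,g,\qquad \gamma\le c\,g .$$ Define for $n\ge0$ $$\varepsilon_{n+1}=\frac{\tilde C_{**}\sqrt{DN}(\gamma+\zeta_n)\varepsilon_n}{\sqrt{(g-\gamma-\zeta_n)^2(1-D\varepsilon_n^2)+D(\gamma+\zeta_n)^2\varepsilon_n^2}},\qquad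 \zeta_{n+1}=\frac{\lambda^h_{q+1,1}}{\tilde C_{**}^2}\varepsilon_{n+1}^2 .$$ Then, for every $n\ge0$ such that the iterations $0,\dots,n$ of the algorithm have been carried out (with shifts different from all $\lambda^h_k$), there are orthonormal bases $\{u^{h,o,n+1}_{ij}\}$ of the $M_h(\lambda_i)$ such that $$\operatorname{dist}(u^{h,o,n+1}_{ij},u^{(n+1)}_{ij})\le\varepsilon_{n+1},\qquad |\lambda^h_{ij}-\lambda^{(n+1)}_{ij}|\le\zeta_{n+1}\qquad\text{for all }(i,j)\le(q,d_q).$$ Moreover, provided that the initial shifts differ from all $\lambda^h_k$, one has $\varepsilon_n>0$ for all $n$, $\varepsilon_n\to0$, and $$\lim_{n\to\infty}\frac{\varepsilon_{n+1}}{\varepsilon_n}=\frac{\tilde C_{**}\sqrt{DN}\,\gamma}{g-\gamma},\qquad\text{and, if }\gamma=0,\qquad \lim_{n\to\infty}\frac{\varepsilon_{n+1}}{\varepsilon_n^3}=\frac{\sqrt{DN}\,\lambda^h_{q+1,1}}{g\,\tilde C_{**}} .$$ -/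

import Mathlib

open Filter Topology

noncomputable section

namespace ParO

variable {H : Type*} [NormedAddCommGroup H] [InnerProductSpace ℝ H]

/-- The standing assumptions on the two symmetric bilinear forms: `a` is bounded and coercive on
`H`, `b` is an inner product, and the norm `√(b v v)` is compact with respect to `‖v‖` (bounded
sequences have subsequences that are Cauchy for it). -/
structure AdmissibleForms (a b : H →ₗ[ℝ] H →ₗ[ℝ] ℝ) : Prop where
  a_symm : ∀ v w, a v w = a w v
  b_symm : ∀ v w, b v w = b w v
  a_bounded : ∃ Ca : ℝ, 0 < Ca ∧ ∀ v w, a v w ≤ Ca * ‖v‖ * ‖w‖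
  a_coercive : ∃ ca : ℝ, 0 < ca ∧ ∀ v, ca * ‖v‖ ^ 2 ≤ a v v
  b_pos : ∀ v, v ≠ 0 → 0 < b v v
  b_compact : ∀ x : ℕ → H, (∃ R : ℝ, ∀ k, ‖x k‖ ≤ R) →
    ∃ φ : ℕ → ℕ, StrictMono φ ∧ ∀ η : ℝ, 0 < η → ∃ K : ℕ, ∀ k ≥ K, ∀ l ≥ K,
      √(b (x (φ k) - x (φ l)) (x (φ k) - x (φ l))) < η

/-- The eigenspace `M(μ)` of the problem `a(u, v) = μ b(u, v)` for all `v ∈ H`. -/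
def eigenspace (a b : H →ₗ[ℝ] H →ₗ[ℝ] ℝ) (μ : ℝ) : Submodule ℝ H where
  carrier := {u | ∀ v, a u v = μ * b u v}
  add_mem' := by
    intro x y hx hy v
    have h1 := hx v
    have h2 := hy v
    simp only [map_add, LinearMap.add_apply, h1, h2]
    ring
  zero_mem' := by
    intro v
    simp
  smul_mem' := by
    intro c x hx v
    have h1 := hx v
    simp only [map_smul, LinearMap.smul_apply, smul_eq_mul, h1]
    ring

/-- `lam 0 < ⋯ < lam (q - 1)` are the `q` smallest eigenvalues (without repetition) of the problem
`a(u, v) = μ b(u, v)` for all `v ∈ H`, and `d i` is the multiplicity of `lam i`. -/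
structure SmallestEigenvalues (a b : H →ₗ[ℝ] H →ₗ[ℝ] ℝ) (q : ℕ) (lam : ℕ → ℝ) (d : ℕ → ℕ) :
    Prop where
  strictMono : StrictMonoOn lam (Set.Iio q)
  multiplicity_pos : ∀ i < q, 0 < d i
  multiplicity : ∀ i < q, Module.finrank ℝ (eigenspace a b (lam i)) = d i
  smallest : ∀ μ : ℝ, eigenspace a b μ ≠ ⊥ → (∃ i < q, μ = lam i) ∨ ∀ i < q, lam i < μ

/-- `(lam k, u k)`, `k < m`, are eigenpairs of the problem `a(u, v) = μ b(u, v)` for all `v ∈ V`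
on the subspace `V`, with `u k ∈ V`, `b(u k, u l) = δ_{kl}` and nondecreasing `lam`. -/
structure OrderedEigenpairs (a b : H →ₗ[ℝ] H →ₗ[ℝ] ℝ) (V : Submodule ℝ H) (m : ℕ)
    (lam : ℕ → ℝ) (u : ℕ → H) : Prop where
  mem : ∀ k < m, u k ∈ V
  orthonormal : ∀ k < m, ∀ l < m, b (u k) (u l) = if k = l then 1 else 0
  eigen : ∀ k < m, ∀ v ∈ V, a (u k) v = lam k * b (u k) v
  mono : MonotoneOn lam (Set.Iio m)

/-- The energy norm `√(a v v)`. -/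
def energyNorm (a : H →ₗ[ℝ] H →ₗ[ℝ] ℝ) (v : H) : ℝ := √(a v v)

/-- The distance from the subspace `U` to the subspace `V` in the energy norm. -/
def subspaceDist (a : H →ₗ[ℝ] H →ₗ[ℝ] ℝ) (U V : Submodule ℝ H) : ℝ :=
  sSup {r : ℝ | ∃ u ∈ U, energyNorm a u = 1 ∧
    r = sInf {t : ℝ | ∃ v ∈ V, t = energyNorm a (u - v)}}

/-- The distance between two vectors: the distance from one line to the other. -/
def vecDist (a : H →ₗ[ℝ] H →ₗ[ℝ] ℝ) (x y : H) : ℝ :=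
  subspaceDist a (Submodule.span ℝ {x}) (Submodule.span ℝ {y})

/-- `d 0 + ⋯ + d (i - 1)`. Clusters are numbered `i = 0, …, q - 1`, positions in the cluster `i`
are numbered `j = 0, …, d i - 1`, and the pair `(i, j)` has the linear index `start d i + j`.
In particular `start d q` is the total number `N`, and the linear index `start d q` is that of the
first position after the `q` clusters. -/
def start (d : ℕ → ℕ) (i : ℕ) : ℕ := ∑ r ∈ Finset.range i, d r

/-- The linear indices of the cluster `i`. -/
def cluster (d : ℕ → ℕ) (i : ℕ) : Set ℕ := Set.Ico (start d i) (start d (i + 1))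

/-- The span of the vectors of the cluster `i`; for discrete eigenfunctions this is the discrete
eigenspace `M_h(λ_i)`. -/
def clusterSpan (d : ℕ → ℕ) (u : ℕ → H) (i : ℕ) : Submodule ℝ H :=
  Submodule.span ℝ (u '' cluster d i)

/-- `o` consists of orthonormal bases (for `b`) of the discrete eigenspaces of the first `q`
clusters of `uh`, with `b(o_{ij}, o_{kl}) = δ_{ik} δ_{jl}`. -/
structure OrthonormalBases (b : H →ₗ[ℝ] H →ₗ[ℝ] ℝ) (q : ℕ) (d : ℕ → ℕ) (uh o : ℕ → H) : Prop where
  span_eq : ∀ i < q, clusterSpan d o i = clusterSpan d uh i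
  orthonormal : ∀ k < start d q, ∀ l < start d q, b (o k) (o l) = if k = l then 1 else 0

/-- The gap `g`: the minimum over clusters `i < r` (`r = q` stands for the first eigenvalue after
the `q` clusters) of the distance of the last eigenvalue of the cluster `i` to the first one of the
cluster `r`. -/
def gap (q : ℕ) (d : ℕ → ℕ) (lamh : ℕ → ℝ) : ℝ :=
  sInf ((fun p : ℕ × ℕ => |lamh (start d (p.1 + 1) - 1) - lamh (start d p.2)|) ''
    {p | p.1 < p.2 ∧ p.2 ≤ q})

/-- The cluster spread `γ`: the maximum over `i` of the last minus the first eigenvalue of the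
cluster `i`. -/
def spread (q : ℕ) (d : ℕ → ℕ) (lamh : ℕ → ℝ) : ℝ :=
  sSup ((fun i : ℕ => lamh (start d (i + 1) - 1) - lamh (start d i)) '' Set.Iio q)

/-- The coefficients of the convex combinations `𝒞_i`, one for each cluster. -/
def ConvexWeights (q : ℕ) (d : ℕ → ℕ) (w : ℕ → ℕ → ℝ) : Prop :=
  ∀ i < q, (∀ j < d i, 0 ≤ w i j) ∧ ∑ j ∈ Finset.range (d i), w i j = 1

/-- The convex combination `𝒞_i` of the values `lam` in the cluster `i`. -/
def shift (d : ℕ → ℕ) (w : ℕ → ℕ → ℝ) (lam : ℕ → ℝ) (i : ℕ) : ℝ :=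
  ∑ j ∈ Finset.range (d i), w i j * lam (start d i + j)

/-- The initial shift error `ζ₀`: the maximum over `i` of `|𝒞_i(λ^h) - 𝒞_i(λ^(0))|`. -/
def shiftError (q : ℕ) (d : ℕ → ℕ) (w : ℕ → ℕ → ℝ) (lamh lam : ℕ → ℝ) : ℝ :=
  sSup ((fun i : ℕ => |shift d w lamh i - shift d w lam i|) '' Set.Iio q)

/-- No shift formed from `lam` is one of the `m` discrete eigenvalues `lamh`. -/
def ShiftsRegular (q : ℕ) (d : ℕ → ℕ) (w : ℕ → ℕ → ℝ) (m : ℕ) (lamh lam : ℕ → ℝ) : Prop :=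
  ∀ i < q, ∀ k < m, shift d w lam i ≠ lamh k

/-- One iteration of the shifted-inverse parallel orbital-updating algorithm on `V`, from the data
`(lam, u)` to `(lam', u')` through the solutions `uhalf` of the source problems: the shifts are
formed from `lam`, the source problems are solved, and the `N` eigenpairs of the problem projected
onto the span of `uhalf` are computed. -/
structure ShiftedInverseStep (a b : H →ₗ[ℝ] H →ₗ[ℝ] ℝ) (V : Submodule ℝ H) (q : ℕ) (d : ℕ → ℕ)
    (w : ℕ → ℕ → ℝ) (lam : ℕ → ℝ) (u uhalf : ℕ → H) (lam' : ℕ → ℝ) (u' : ℕ → H) : Prop where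
  half_mem : ∀ k < start d q, uhalf k ∈ V
  source : ∀ i < q, ∀ k ∈ cluster d i, ∀ v ∈ V,
    a (uhalf k) v - shift d w lam i * b (uhalf k) v = shift d w lam i * b (u k) v
  projected : OrderedEigenpairs a b (Submodule.span ℝ (uhalf '' Set.Iio (start d q)))
    (start d q) lam' u'

/-- `C` is an admissible constant, with radius `δ`, in the estimate for the projected eigenvalue
problem: for every `N`-dimensional subspace `U` of `V` whose distance from the sum of the first `q`
discrete eigenspaces is at most `δ`, the eigenfunctions obtained in `U` are, up to `C` times this
distance, orthonormal bases of the discrete eigenspaces. -/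
def ProjectionConstant (a b : H →ₗ[ℝ] H →ₗ[ℝ] ℝ) (V : Submodule ℝ H) (q : ℕ) (d : ℕ → ℕ)
    (uh : ℕ → H) (C δ : ℝ) : Prop :=
  ∀ (U : Submodule ℝ H) (lam : ℕ → ℝ) (u : ℕ → H), U ≤ V → Module.finrank ℝ U = start d q →
    OrderedEigenpairs a b U (start d q) lam u →
    subspaceDist a (Submodule.span ℝ (uh '' Set.Iio (start d q))) U ≤ δ →
    ∃ o : ℕ → H, OrthonormalBases b q d uh o ∧ ∀ k < start d q,
      vecDist a (o k) (u k) ≤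
        C * subspaceDist a (Submodule.span ℝ (uh '' Set.Iio (start d q))) U

end ParO

end

/-!
Everything takes place in the finite-dimensional space `V`, where the discrete eigenvectors are
coordinates in which both forms are diagonal. Let `E` be the span of the first `N` eigenvectors and
`M i` the part of `E` belonging to the cluster `i`.

**The projected problem.** Let `U` be an `N`-dimensional trial space at distance `δ` from `E`. For
spaces of equal dimension this distance is symmetric (`IsInnerForm.dist_symm`), so the orthogonal
projection maps `U` onto `E`, and testing the min-max principle with the preimages of the
eigenvectors gives `λ_k ≤ μ_k ≤ λ_k / (1 - δ²)` for the Ritz values (`le_ritzValue`,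
`mul_ritzValue_le`). As the gap separates `λ_k` from `Λ = λ_{N+1}`, this becomes
`μ_k - λ_k ≤ Λ δ²` with the constant exactly `Λ` (`ritzValue_bounds`). A Ritz vector `x_k` satisfies
`(μ_k - λ_l) b(x_k, u_l) = μ_k b(x_k, u_l - Q u_l)`, `Q` being the energy projection onto `U`, so its
components along the other clusters are of order `δ` (`ritzVector_residual_le`). The projections of
the Ritz vectors to the eigenspaces `M i` are then nearly orthonormal, and the Gram–Schmidt process
turns them into orthonormal bases (`exists_orthonormalFamily_near`, `projectionConstant`).

**One iteration.** If the approximations of the cluster `i` are within `ε` of an orthonormal basis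
of `M i`, their span is within `√(K_i) ε` of `M i`, where `K_i` is `d i` times the ratio of the
extreme eigenvalues of the cluster (`dist_span_le_of_vecDist_le`). Shifted inversion maps `M i` to
itself and multiplies the tangent of the angle by at most `(γ + ζ) / (g - γ - ζ)`
(`dist_span_le_of_shiftedInverse`). The contributions of the clusters are orthogonal and add up in
the mean square (`dist_span_le_of_clusters`). This gives a distance of at most `ε' / C`, where `ε'`
is the next term of the recursion. The ratio of the extreme eigenvalues, which is absent from the
recursion, is harmless: it is `1` for a simple eigenvalue, and a cluster with `d i ≥ 2` needs only
the fraction `1 / d i` of the bound that the factor `√(D N)` provides (`contraction_le`). The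
estimate for the projected problem then yields the new bases and the bound `Λ (ε' / C)²` for the
eigenvalues.

**The recursion.** For small `c` each step at least halves `ε`, so `ε` and `ζ` tend to `0`, and the
limits of the ratios are read off from the recursion. Positivity uses that the initial shifts are
not eigenvalues: `γ + ζ₀ = 0` would make the shift of the first cluster equal to its eigenvalue.
-/

namespace ParO

variable {H : Type*} [NormedAddCommGroup H] [InnerProductSpace ℝ H]

/-! ### Inner product forms and the norm they induce -/

/-- A bilinear form that is an inner product, not necessarily the one of `H`. Both `a` and `b` are
of this kind, and `energyNorm` is the norm induced by either of them. -/
structure IsInnerForm (p : H →ₗ[ℝ] H →ₗ[ℝ] ℝ) : Prop where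
  symm : ∀ v w, p v w = p w v
  pos : ∀ v, v ≠ 0 → 0 < p v v

lemma AdmissibleForms.isInnerForm_left {a b : H →ₗ[ℝ] H →ₗ[ℝ] ℝ} (h : AdmissibleForms a b) :
    IsInnerForm a where
  symm := h.a_symm
  pos v hv := by
    obtain ⟨ca, hca, hc⟩ := h.a_coercive
    have : 0 < ‖v‖ := norm_pos_iff.2 hv
    exact lt_of_lt_of_le (by positivity) (hc v)

lemma AdmissibleForms.isInnerForm_right {a b : H →ₗ[ℝ] H →ₗ[ℝ] ℝ} (h : AdmissibleForms a b) :
    IsInnerForm b :=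
  ⟨h.b_symm, h.b_pos⟩

lemma energyNorm_nonneg (p : H →ₗ[ℝ] H →ₗ[ℝ] ℝ) (v : H) : 0 ≤ energyNorm p v :=
  Real.sqrt_nonneg _

namespace IsInnerForm

variable {p : H →ₗ[ℝ] H →ₗ[ℝ] ℝ}

lemma nonneg (hp : IsInnerForm p) (v : H) : 0 ≤ p v v := by
  by_cases hv : v = 0
  · simp [hv]
  · exact (hp.pos v hv).le

lemma eq_zero_of_nonpos (hp : IsInnerForm p) {v : H} (h : p v v ≤ 0) : v = 0 := by
  by_contra hv
  exact absurd (hp.pos v hv) (not_lt.2 h)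

lemma sq_le (hp : IsInnerForm p) (v w : H) : (p v w) ^ 2 ≤ p v v * p w w := by
  by_cases hw : w = 0
  · simp [hw]
  have h := hp.nonneg ((p w w) • v - (p v w) • w)
  have hw' := hp.pos w hw
  simp only [map_sub, map_smul, LinearMap.sub_apply, LinearMap.smul_apply, smul_eq_mul,
    hp.symm w v] at h
  have h2 : 0 ≤ p w w * (p v v * p w w - (p v w) ^ 2) := by nlinarith
  nlinarith [nonneg_of_mul_nonneg_right h2 hw']

lemma energyNorm_sq (hp : IsInnerForm p) (v : H) : energyNorm p v ^ 2 = p v v :=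
  Real.sq_sqrt (hp.nonneg v)

lemma energyNorm_pos (hp : IsInnerForm p) {v : H} (hv : v ≠ 0) : 0 < energyNorm p v :=
  Real.sqrt_pos.2 (hp.pos v hv)

lemma abs_le (hp : IsInnerForm p) (v w : H) : |p v w| ≤ energyNorm p v * energyNorm p w := by
  apply abs_le_of_sq_le_sq _ (mul_nonneg (energyNorm_nonneg _ _) (energyNorm_nonneg _ _))
  rw [mul_pow, hp.energyNorm_sq, hp.energyNorm_sq]
  exact hp.sq_le v w

lemma energyNorm_zero (p : H →ₗ[ℝ] H →ₗ[ℝ] ℝ) : energyNorm p 0 = 0 := by simp [energyNorm]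

lemma energyNorm_smul (p : H →ₗ[ℝ] H →ₗ[ℝ] ℝ) (t : ℝ) (v : H) :
    energyNorm p (t • v) = |t| * energyNorm p v := by
  simp only [energyNorm, map_smul, LinearMap.smul_apply, smul_eq_mul]
  rw [← mul_assoc, Real.sqrt_mul (mul_self_nonneg t), Real.sqrt_mul_self_eq_abs]

lemma energyNorm_add_le (hp : IsInnerForm p) (v w : H) :
    energyNorm p (v + w) ≤ energyNorm p v + energyNorm p w := by
  apply le_of_sq_le_sq _ (add_nonneg (energyNorm_nonneg _ _) (energyNorm_nonneg _ _))
  have h := (le_abs_self _).trans (hp.abs_le v w)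
  rw [add_sq, hp.energyNorm_sq, hp.energyNorm_sq, hp.energyNorm_sq]
  simp only [map_add, LinearMap.add_apply, hp.symm w v]
  linarith

lemma energyNorm_sub_rev (p : H →ₗ[ℝ] H →ₗ[ℝ] ℝ) (v w : H) :
    energyNorm p (v - w) = energyNorm p (w - v) := by
  rw [← neg_sub w v, ← neg_one_smul ℝ, energyNorm_smul]; simp

lemma energyNorm_sub_le (hp : IsInnerForm p) (u v w : H) :
    energyNorm p (u - w) ≤ energyNorm p (u - v) + energyNorm p (v - w) := by
  have := hp.energyNorm_add_le (u - v) (v - w)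
  rwa [sub_add_sub_cancel] at this

lemma abs_energyNorm_sub_le (hp : IsInnerForm p) (v w : H) :
    |energyNorm p v - energyNorm p w| ≤ energyNorm p (v - w) := by
  have h1 := hp.energyNorm_sub_le v w 0
  have h2 := hp.energyNorm_sub_le w v 0
  rw [energyNorm_sub_rev p w v] at h2
  simp only [sub_zero] at h1 h2
  exact abs_sub_le_iff.2 ⟨by linarith, by linarith⟩

lemma energyNorm_sum_le (hp : IsInnerForm p) {ι : Type*} (s : Finset ι) (f : ι → H) :
    energyNorm p (∑ i ∈ s, f i) ≤ ∑ i ∈ s, energyNorm p (f i) := by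
  classical
  induction s using Finset.induction_on with
  | empty => simp [energyNorm_zero]
  | insert i s hi ih =>
    rw [Finset.sum_insert hi, Finset.sum_insert hi]
    exact (hp.energyNorm_add_le _ _).trans (by linarith)

lemma energyNorm_le_mul_iff (hp : IsInnerForm p) {v w : H} {r : ℝ} (hr : 0 ≤ r) :
    energyNorm p v ≤ r * energyNorm p w ↔ p v v ≤ r ^ 2 * p w w := by
  rw [← hp.energyNorm_sq, ← hp.energyNorm_sq, ← mul_pow]
  exact (pow_le_pow_iff_left₀ (energyNorm_nonneg _ _)
    (mul_nonneg hr (energyNorm_nonneg _ _)) two_ne_zero).symm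

lemma apply_add_of_orthogonal (hp : IsInnerForm p) {x y : H} (h : p x y = 0) :
    p (x + y) (x + y) = p x x + p y y := by
  simp only [map_add, LinearMap.add_apply, hp.symm y x, h]
  ring

lemma apply_eq_add_of_orthogonal (hp : IsInnerForm p) {x y : H} (h : p (x - y) y = 0) :
    p x x = p (x - y) (x - y) + p y y := by
  have := hp.apply_add_of_orthogonal h
  rwa [sub_add_cancel] at this

/-- The orthogonal projection onto a finite-dimensional subspace, as a linear map. -/
lemma exists_projection (hp : IsInnerForm p) (W : Submodule ℝ H) [FiniteDimensional ℝ W] :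
    ∃ π : H →ₗ[ℝ] H, (∀ x, π x ∈ W) ∧ ∀ x, ∀ w ∈ W, p (x - π x) w = 0 := by
  let Φ : W →ₗ[ℝ] Module.Dual ℝ W := (p.domRestrict₁₂ W W)
  have hΦ : Function.Injective Φ := by
    rw [← LinearMap.ker_eq_bot, LinearMap.ker_eq_bot']
    intro w hw
    have : p w w = 0 := LinearMap.congr_fun hw w
    exact Subtype.ext (hp.eq_zero_of_nonpos this.le)
  let e := LinearEquiv.ofInjectiveOfFinrankEq Φ hΦ (Subspace.dual_finrank_eq).symm
  let R : H →ₗ[ℝ] Module.Dual ℝ W := W.subtype.dualMap ∘ₗ p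
  refine ⟨W.subtype ∘ₗ e.symm.toLinearMap ∘ₗ R, fun x => Submodule.coe_mem _, fun x w hw => ?_⟩
  have h : e (e.symm (R x)) = R x := e.apply_symm_apply _
  have h2 := LinearMap.congr_fun h ⟨w, hw⟩
  have h3 : p (e.symm (R x) : W) w = p x w := h2
  simp only [LinearMap.comp_apply, map_sub, LinearMap.sub_apply, Submodule.subtype_apply,
    LinearEquiv.coe_coe]
  rw [h3, sub_self]

lemma apply_sub_le_of_orthogonal (hp : IsInnerForm p) {W : Submodule ℝ H} {x y v : H}
    (hy : y ∈ W) (h : ∀ w ∈ W, p (x - y) w = 0) (hv : v ∈ W) :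
    p (x - y) (x - y) ≤ p (x - v) (x - v) := by
  have h1 := hp.apply_add_of_orthogonal (h (y - v) (W.sub_mem hy hv))
  rw [sub_add_sub_cancel] at h1
  rw [h1]
  linarith [hp.nonneg (y - v)]

/-! ### Distances of subspaces -/

lemma sInf_energyNorm_le (p : H →ₗ[ℝ] H →ₗ[ℝ] ℝ) {V : Submodule ℝ H} (u : H) {v : H}
    (hv : v ∈ V) : sInf {t : ℝ | ∃ v ∈ V, t = energyNorm p (u - v)} ≤ energyNorm p (u - v) := by
  refine csInf_le ⟨0, ?_⟩ ⟨v, hv, rfl⟩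
  rintro _ ⟨w, -, rfl⟩
  exact energyNorm_nonneg _ _

lemma subspaceDist_le {U V : Submodule ℝ H} {r : ℝ} (hr : 0 ≤ r)
    (h : ∀ u ∈ U, ∃ v ∈ V, energyNorm p (u - v) ≤ r * energyNorm p u) :
    subspaceDist p U V ≤ r := by
  apply Real.sSup_le _ hr
  rintro x ⟨u, hu, hu1, rfl⟩
  obtain ⟨v, hv, hle⟩ := h u hu
  rw [hu1, mul_one] at hle
  exact (sInf_energyNorm_le p u hv).trans hle

lemma subspaceDist_nonneg (p : H →ₗ[ℝ] H →ₗ[ℝ] ℝ) (U V : Submodule ℝ H) :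
    0 ≤ subspaceDist p U V := by
  apply Real.sSup_nonneg
  rintro x ⟨u, hu, hu1, rfl⟩
  apply Real.sInf_nonneg
  rintro _ ⟨w, -, rfl⟩
  exact energyNorm_nonneg _ _

/-- The distance to a finite-dimensional subspace is attained, by the orthogonal projection. -/
lemma exists_energyNorm_sub_le (hp : IsInnerForm p) {U V : Submodule ℝ H}
    [FiniteDimensional ℝ V] {u : H} (hu : u ∈ U) :
    ∃ v ∈ V, energyNorm p (u - v) ≤ subspaceDist p U V * energyNorm p u := by
  by_cases hu0 : u = 0
  · exact ⟨0, V.zero_mem, by simp [hu0, energyNorm_zero]⟩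
  obtain ⟨π, hπ, hort⟩ := hp.exists_projection V
  refine ⟨π u, hπ u, ?_⟩
  have hpos := hp.energyNorm_pos hu0
  set n := energyNorm p u with hn
  have hu1 : energyNorm p (n⁻¹ • u) = 1 := by
    rw [energyNorm_smul, abs_of_pos (inv_pos.2 hpos), ← hn, inv_mul_cancel₀ hpos.ne']
  have hle : energyNorm p (n⁻¹ • u - π (n⁻¹ • u)) ≤ subspaceDist p U V := by
    have hmem : sInf {t : ℝ | ∃ v ∈ V, t = energyNorm p (n⁻¹ • u - v)} ≤ subspaceDist p U V := by
      rw [subspaceDist]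
      refine le_csSup ⟨1, ?_⟩ ⟨n⁻¹ • u, U.smul_mem _ hu, hu1, rfl⟩
      rintro x ⟨y, hy, hy1, rfl⟩
      rw [← hy1]
      simpa using sInf_energyNorm_le p y V.zero_mem
    refine le_trans ?_ hmem
    refine le_csInf ⟨_, 0, V.zero_mem, rfl⟩ ?_
    rintro _ ⟨v, hv, rfl⟩
    apply Real.sqrt_le_sqrt
    exact hp.apply_sub_le_of_orthogonal (hπ _) (hort _) hv
  rw [map_smul, ← smul_sub, energyNorm_smul, abs_of_pos (inv_pos.2 hpos)] at hle
  rwa [inv_mul_le_iff₀ hpos, mul_comm] at hle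

/-- If `E` is close to `U` and `U` is not larger than `E`, then `U` is as close to `E`, and the
orthogonal projection maps `U` onto `E`. -/
lemma dist_symm (hp : IsInnerForm p) {E U : Submodule ℝ H} [FiniteDimensional ℝ E]
    [FiniteDimensional ℝ U] (hdim : Module.finrank ℝ U ≤ Module.finrank ℝ E) {s : ℝ}
    (hs : s ^ 2 < 1) (h : ∀ e ∈ E, ∃ u ∈ U, p (e - u) (e - u) ≤ s ^ 2 * p e e) :
    (∀ u ∈ U, ∀ e ∈ E, (∀ f ∈ E, p (u - e) f = 0) → p (u - e) (u - e) ≤ s ^ 2 * p u u) ∧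
      ∀ e ∈ E, ∃ u ∈ U, ∀ f ∈ E, p (u - e) f = 0 := by
  obtain ⟨Q, hQ, hQo⟩ := hp.exists_projection U
  obtain ⟨P, hP, hPo⟩ := hp.exists_projection E
  have hQE : ∀ e ∈ E, p (e - Q e) (e - Q e) ≤ s ^ 2 * p e e := fun e he => by
    obtain ⟨u, hu, hle⟩ := h e he
    exact (hp.apply_sub_le_of_orthogonal (hQ e) (hQo e) hu).trans hle
  let QE : E →ₗ[ℝ] U := (Q.codRestrict U hQ).domRestrict E
  have hQinj : Function.Injective QE := by
    rw [← LinearMap.ker_eq_bot, LinearMap.ker_eq_bot']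
    intro e he
    have h0 : Q e = 0 := congrArg Subtype.val he
    have h1 := hQE e e.2
    rw [h0, sub_zero] at h1
    exact Subtype.ext (hp.eq_zero_of_nonpos (by nlinarith [hp.nonneg (e : H)]))
  have hdim' : Module.finrank ℝ E = Module.finrank ℝ U :=
    le_antisymm (LinearMap.finrank_le_finrank_of_injective hQinj) hdim
  have hQsurj : Function.Surjective QE :=
    (LinearMap.injective_iff_surjective_of_finrank_eq_finrank hdim').1 hQinj
  have key : ∀ u ∈ U, ∀ e ∈ E, (∀ f ∈ E, p (u - e) f = 0) →
      p (u - e) (u - e) ≤ s ^ 2 * p u u := by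
    intro u hu e he ho
    obtain ⟨e₀, he₀⟩ := hQsurj ⟨u, hu⟩
    have hu₀ : Q e₀ = u := congrArg Subtype.val he₀
    have h1 := hQE e₀ e₀.2
    have h2 := hp.apply_eq_add_of_orthogonal (hQo e₀ (Q e₀) (hQ e₀))
    have h3 := hp.apply_eq_add_of_orthogonal (ho e he)
    have h4 := hQo e₀ u hu
    have h5 := ho e₀ e₀.2
    have h6 := hp.sq_le e e₀
    rw [hu₀] at h1 h2 h4
    simp only [map_sub (p), LinearMap.sub_apply] at h4 h5
    rw [hp.symm (e₀ : H) u] at h4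
    have h7 : p e e₀ = p u u := by linarith
    rw [h7] at h6
    -- `‖u‖⁴ ≤ ‖e‖² ‖e₀‖²` and `(1 - s²) ‖e₀‖² ≤ ‖u‖²`
    have h8 : (1 - s ^ 2) * p (e₀ : H) e₀ ≤ p u u := by linarith
    have h9 := hp.nonneg e
    have h10 := hp.nonneg u
    rcases h10.eq_or_lt with h0 | h0
    · rw [← h0] at h3 ⊢
      linarith [hp.nonneg (u - e)]
    · have : (1 - s ^ 2) * p u u * p u u ≤ p e e * p u u := by
        nlinarith [mul_le_mul_of_nonneg_left h8 h9]
      have := le_of_mul_le_mul_right this h0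
      linarith
  refine ⟨key, ?_⟩
  let PU : U →ₗ[ℝ] E := (P.codRestrict E hP).domRestrict U
  have hPinj : Function.Injective PU := by
    rw [← LinearMap.ker_eq_bot, LinearMap.ker_eq_bot']
    intro u hu
    have h0 : P u = 0 := congrArg Subtype.val hu
    have h1 := key u u.2 (P u) (hP u) (hPo u)
    rw [h0, sub_zero] at h1
    exact Subtype.ext (hp.eq_zero_of_nonpos (by nlinarith [hp.nonneg (u : H)]))
  have hPsurj : Function.Surjective PU :=
    (LinearMap.injective_iff_surjective_of_finrank_eq_finrank hdim'.symm).1 hPinj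
  intro e he
  obtain ⟨u, hu⟩ := hPsurj ⟨e, he⟩
  have h0 : P u = e := congrArg Subtype.val hu
  exact ⟨u, u.2, by rw [← h0]; exact hPo u⟩

/-- If `y` is orthogonal to `e` and of length at most `τ ‖e‖`, then `e` is within `sin (arctan τ)`
of the line through `e + y`. -/
lemma exists_smul_close (hp : IsInnerForm p) {e y : H} {τ : ℝ} (ho : p e y = 0)
    (hy : p y y ≤ τ ^ 2 * p e e) :
    ∃ t : ℝ, p (e - t • (e + y)) (e - t • (e + y)) ≤ τ ^ 2 / (1 + τ ^ 2) * p e e := by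
  -- the optimal multiple is the squared cosine of the angle
  refine ⟨1 / (1 + τ ^ 2), ?_⟩
  set t := 1 / (1 + τ ^ 2) with ht
  have hpos : 0 < 1 + τ ^ 2 := by positivity
  have h1 : p (e - t • (e + y)) (e - t • (e + y)) = (1 - t) ^ 2 * p e e + t ^ 2 * p y y := by
    simp only [map_sub, map_add, map_smul, LinearMap.sub_apply, LinearMap.add_apply,
      LinearMap.smul_apply, smul_eq_mul, hp.symm y e, ho]
    ring
  rw [h1]
  have h2 : τ ^ 2 / (1 + τ ^ 2) = (1 - t) ^ 2 + t ^ 2 * τ ^ 2 := by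
    rw [ht]; field_simp; ring
  rw [h2]
  nlinarith [mul_le_mul_of_nonneg_left hy (sq_nonneg t)]

end IsInnerForm

variable {a b : H →ₗ[ℝ] H →ₗ[ℝ] ℝ}

/-! ### Orthonormal families and eigenpairs -/

/-- The vectors `v k`, `k ∈ S`, are orthonormal for the form `b`. -/
def OrthonormalFamily (b : H →ₗ[ℝ] H →ₗ[ℝ] ℝ) (v : ℕ → H) (S : Finset ℕ) : Prop :=
  ∀ k ∈ S, ∀ l ∈ S, b (v k) (v l) = if k = l then 1 else 0

/-- The part of `x` in the directions `v k`, `k ∈ S`; for a `b`-orthonormal family this is the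
`b`-orthogonal projection of `x` onto the span of these vectors. -/
def part (b : H →ₗ[ℝ] H →ₗ[ℝ] ℝ) (v : ℕ → H) (S : Finset ℕ) (x : H) : H :=
  ∑ k ∈ S, b x (v k) • v k

lemma part_mem (b : H →ₗ[ℝ] H →ₗ[ℝ] ℝ) (v : ℕ → H) (S : Finset ℕ) (x : H) :
    part b v S x ∈ Submodule.span ℝ (v '' S) :=
  Submodule.sum_mem _ fun k hk =>
    Submodule.smul_mem _ _ (Submodule.subset_span ⟨k, hk, rfl⟩)

namespace OrthonormalFamily

variable {v : ℕ → H} {S T : Finset ℕ}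

lemma mono (h : OrthonormalFamily b v T) (hST : S ⊆ T) : OrthonormalFamily b v S :=
  fun k hk l hl => h k (hST hk) l (hST hl)

lemma sum_apply (h : OrthonormalFamily b v T) (hST : S ⊆ T) (c : ℕ → ℝ) {l : ℕ} (hl : l ∈ T) :
    b (∑ k ∈ S, c k • v k) (v l) = if l ∈ S then c l else 0 := by
  simp only [map_sum, LinearMap.sum_apply, map_smul, LinearMap.smul_apply, smul_eq_mul]
  rw [← Finset.sum_ite_eq' S l c]
  refine Finset.sum_congr rfl fun k hk => ?_
  rw [h k (hST hk) l hl]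
  split_ifs <;> simp

lemma part_apply (h : OrthonormalFamily b v T) (hST : S ⊆ T) (x : H) {l : ℕ} (hl : l ∈ T) :
    b (part b v S x) (v l) = if l ∈ S then b x (v l) else 0 :=
  h.sum_apply hST _ hl

lemma sum_self (h : OrthonormalFamily b v S) (c : ℕ → ℝ) :
    b (∑ k ∈ S, c k • v k) (∑ k ∈ S, c k • v k) = ∑ k ∈ S, c k ^ 2 := by
  rw [map_sum]
  refine Finset.sum_congr rfl fun k hk => ?_
  rw [map_smul, h.sum_apply subset_rfl c hk, if_pos hk, smul_eq_mul, sq]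

lemma linearIndependent (h : OrthonormalFamily b v S) :
    LinearIndependent ℝ (fun k : S => v k) := by
  rw [Fintype.linearIndependent_iff]
  intro c hc k
  have h1 : b (∑ l : S, c l • v l) (v k) = c k := by
    simp only [map_sum, LinearMap.sum_apply, map_smul, LinearMap.smul_apply, smul_eq_mul]
    rw [Finset.sum_eq_single k]
    · rw [h k k.2 k k.2]; simp
    · intro l _ hl
      rw [h l l.2 k k.2, if_neg (fun e => hl (Subtype.ext e)), mul_zero]
    · simp
  rw [← h1, hc]; simp

lemma image_eq_range {M : Type*} (v : ℕ → M) (S : Finset ℕ) :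
    v '' (S : Set ℕ) = Set.range (fun k : S => v k) := by
  ext x; simp

lemma finrank_span (h : OrthonormalFamily b v S) :
    Module.finrank ℝ (Submodule.span ℝ (v '' S)) = S.card := by
  rw [image_eq_range, finrank_span_eq_card h.linearIndependent, Fintype.card_coe]

lemma eq_part (h : OrthonormalFamily b v S) {x : H} (hx : x ∈ Submodule.span ℝ (v '' S)) :
    x = part b v S x := by
  induction hx using Submodule.span_induction with
  | mem x hx =>
    obtain ⟨k, hk, rfl⟩ := hx
    rw [part, Finset.sum_eq_single k]
    · rw [h k hk k hk]; simp
    · intro l hl hlk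
      rw [h k hk l hl, if_neg hlk.symm, zero_smul]
    · intro h'; exact absurd hk h'
  | zero => simp [part]
  | add x y _ _ hx hy =>
    conv_lhs => rw [hx, hy]
    simp [part, Finset.sum_add_distrib, add_smul]
  | smul t x _ hx =>
    conv_lhs => rw [hx]
    simp [part, Finset.smul_sum, smul_smul]

end OrthonormalFamily

instance (v : ℕ → H) (S : Finset ℕ) :
    FiniteDimensional ℝ (Submodule.span ℝ (v '' (S : Set ℕ))) :=
  FiniteDimensional.span_of_finite ℝ (S.finite_toSet.image v)

namespace OrderedEigenpairs

variable {V : Submodule ℝ H} {m : ℕ} {lam : ℕ → ℝ} {u : ℕ → H}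

lemma orthonormalFamily (h : OrderedEigenpairs a b V m lam u) :
    OrthonormalFamily b u (Finset.range m) :=
  fun k hk l hl => h.orthonormal k (Finset.mem_range.1 hk) l (Finset.mem_range.1 hl)

lemma span_le (h : OrderedEigenpairs a b V m lam u) {S : Finset ℕ} (hS : S ⊆ Finset.range m) :
    Submodule.span ℝ (u '' S) ≤ V := by
  rw [Submodule.span_le]
  rintro _ ⟨k, hk, rfl⟩
  exact h.mem k (Finset.mem_range.1 (hS hk))

lemma part_mem (h : OrderedEigenpairs a b V m lam u) {S : Finset ℕ} (hS : S ⊆ Finset.range m)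
    (x : H) : part b u S x ∈ V :=
  h.span_le hS (ParO.part_mem b u S x)

lemma expand (h : OrderedEigenpairs a b V m lam u) [FiniteDimensional ℝ V]
    (hm : Module.finrank ℝ V = m) {x : H} (hx : x ∈ V) : x = part b u (Finset.range m) x := by
  apply h.orthonormalFamily.eq_part
  rwa [Submodule.eq_of_le_of_finrank_eq (h.span_le subset_rfl)
    (by rw [h.orthonormalFamily.finrank_span, hm, Finset.card_range])]

lemma apply_right_eq (h : OrderedEigenpairs a b V m lam u) [FiniteDimensional ℝ V]
    (hm : Module.finrank ℝ V = m) (hb : IsInnerForm b) {x y : H} (hx : x ∈ V) :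
    b x y = ∑ k ∈ Finset.range m, b x (u k) * b y (u k) := by
  conv_lhs => rw [h.expand hm hx, part]
  simp only [map_sum, LinearMap.sum_apply, map_smul, LinearMap.smul_apply, smul_eq_mul, hb.symm y]

lemma apply_left_eq (h : OrderedEigenpairs a b V m lam u) [FiniteDimensional ℝ V]
    (hm : Module.finrank ℝ V = m) (hb : IsInnerForm b) {x y : H} (hx : x ∈ V) (hy : y ∈ V) :
    a x y = ∑ k ∈ Finset.range m, lam k * (b x (u k) * b y (u k)) := by
  conv_lhs => rw [h.expand hm hx, part]
  simp only [map_sum, LinearMap.sum_apply, map_smul, LinearMap.smul_apply, smul_eq_mul]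
  refine Finset.sum_congr rfl fun k hk => ?_
  rw [h.eigen k (Finset.mem_range.1 hk) y hy, hb.symm y]
  ring

lemma apply_left_self (h : OrderedEigenpairs a b V m lam u) {k : ℕ} (hk : k < m) :
    a (u k) (u k) = lam k := by
  rw [h.eigen k hk _ (h.mem k hk), h.orthonormal k hk k hk, if_pos rfl, mul_one]

lemma pos (h : OrderedEigenpairs a b V m lam u) (ha : IsInnerForm a) {k : ℕ} (hk : k < m) :
    0 < lam k := by
  rw [← h.apply_left_self hk]
  apply ha.pos
  intro h0
  have := h.orthonormal k hk k hk
  simp [h0] at this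

lemma le_of_le (h : OrderedEigenpairs a b V m lam u) {k l : ℕ} (hkl : k ≤ l) (hl : l < m) :
    lam k ≤ lam l :=
  h.mono (hkl.trans_lt hl) hl hkl

/-- A vector of `V` whose coordinates in `S` vanish is energy orthogonal to the span of the `u k`,
`k ∈ S`. -/
lemma apply_left_eq_zero (h : OrderedEigenpairs a b V m lam u) (ha : IsInnerForm a)
    (hb : IsInnerForm b) {S : Finset ℕ} (hS : S ⊆ Finset.range m)
    {x : H} (hx : x ∈ V) (h0 : ∀ k ∈ S, b x (u k) = 0) {f : H}
    (hf : f ∈ Submodule.span ℝ (u '' S)) : a x f = 0 := by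
  rw [(h.orthonormalFamily.mono hS).eq_part hf, part, map_sum]
  refine Finset.sum_eq_zero fun k hk => ?_
  rw [map_smul, ha.symm, h.eigen k (Finset.mem_range.1 (hS hk)) x hx, hb.symm (u k) x, h0 k hk]
  simp

lemma sub_part_apply (h : OrderedEigenpairs a b V m lam u) {S : Finset ℕ}
    (hS : S ⊆ Finset.range m) (x : H) {l : ℕ} (hl : l ∈ Finset.range m) :
    b (x - part b u S x) (u l) = if l ∈ S then 0 else b x (u l) := by
  rw [map_sub, LinearMap.sub_apply, h.orthonormalFamily.part_apply hS x hl]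
  split_ifs <;> simp

lemma sub_part_orthogonal (h : OrderedEigenpairs a b V m lam u) (ha : IsInnerForm a)
    (hb : IsInnerForm b) {S : Finset ℕ} (hS : S ⊆ Finset.range m) {x : H} (hx : x ∈ V) {f : H}
    (hf : f ∈ Submodule.span ℝ (u '' S)) : a (x - part b u S x) f = 0 := by
  apply h.apply_left_eq_zero ha hb hS (V.sub_mem hx (h.part_mem hS x)) _ hf
  intro k hk
  rw [h.sub_part_apply hS x (hS hk), if_pos hk]

/-- One half of the min-max principle: if the Rayleigh quotient is at most `r` on a space of
dimension `k + 1`, then so is the eigenvalue of index `k` (counted from `0`). -/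
lemma eigenvalue_le (h : OrderedEigenpairs a b V m lam u) [FiniteDimensional ℝ V]
    (hm : Module.finrank ℝ V = m) (hb : IsInnerForm b) {k : ℕ}
    {x : ℕ → H} (hx : ∀ j ∈ Finset.range (k + 1), x j ∈ V) {r : ℝ}
    (hr : ∀ c : ℕ → ℝ,
      ∑ j ∈ Finset.range (k + 1), c j ^ 2 ≤
        b (∑ j ∈ Finset.range (k + 1), c j • x j) (∑ j ∈ Finset.range (k + 1), c j • x j) ∧
      a (∑ j ∈ Finset.range (k + 1), c j • x j) (∑ j ∈ Finset.range (k + 1), c j • x j) ≤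
        r * b (∑ j ∈ Finset.range (k + 1), c j • x j)
          (∑ j ∈ Finset.range (k + 1), c j • x j)) :
    lam k ≤ r := by
  -- a nonzero combination that is orthogonal to the first `k` eigenvectors
  let A : (Fin (k + 1) → ℝ) →ₗ[ℝ] (Fin k → ℝ) :=
    Matrix.toLin' (Matrix.of fun (l : Fin k) (j : Fin (k + 1)) => b (x j) (u l))
  obtain ⟨c, hc, hc0⟩ := (Submodule.ne_bot_iff _).1
    (LinearMap.ker_ne_bot_of_finrank_lt (f := A) (by simp))
  let c' : ℕ → ℝ := fun j => if hj : j < k + 1 then c ⟨j, hj⟩ else 0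
  have hc' : ∀ j : Fin (k + 1), c' j = c j := fun j => dif_pos j.2
  obtain ⟨h1, h2⟩ := hr c'
  set w := ∑ j ∈ Finset.range (k + 1), c' j • x j with hw
  have hwV : w ∈ V := V.sum_mem fun j hj => V.smul_mem _ (hx j hj)
  have hort : ∀ l < k, b w (u l) = 0 := by
    intro l hl
    have h3 := congrFun (LinearMap.mem_ker.1 hc) ⟨l, hl⟩
    simp only [A, Matrix.toLin'_apply, Matrix.mulVec, dotProduct, Matrix.of_apply,
      Pi.zero_apply] at h3
    rw [hw, Finset.sum_range]
    simp only [map_sum, LinearMap.sum_apply, map_smul, LinearMap.smul_apply, smul_eq_mul, hc']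
    rw [← h3]
    exact Finset.sum_congr rfl fun j _ => mul_comm _ _
  have hpos : 0 < b w w := by
    refine lt_of_lt_of_le ?_ h1
    obtain ⟨j, hj⟩ := Function.ne_iff.1 hc0
    refine Finset.sum_pos' (fun _ _ => sq_nonneg _) ⟨j, Finset.mem_range.2 j.2, ?_⟩
    rw [hc']
    exact sq_pos_of_ne_zero hj
  have h4 : lam k * b w w ≤ a w w := by
    rw [h.apply_right_eq hm hb hwV, h.apply_left_eq hm hb hwV hwV, Finset.mul_sum]
    refine Finset.sum_le_sum fun l hl => ?_
    rcases lt_or_ge l k with hlk | hlk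
    · simp [hort l hlk]
    · exact mul_le_mul_of_nonneg_right (h.le_of_le hlk (Finset.mem_range.1 hl))
        (mul_self_nonneg _)
  exact le_of_mul_le_mul_right (h4.trans h2) hpos

end OrderedEigenpairs

/-! ### Clusters -/

lemma start_succ (d : ℕ → ℕ) (i : ℕ) : start d (i + 1) = start d i + d i :=
  Finset.sum_range_succ _ _

lemma start_mono (d : ℕ → ℕ) : Monotone (start d) :=
  monotone_nat_of_le_succ fun i => by rw [start_succ]; omega

/-- The linear indices of the cluster `i`, as a finite set. -/
def clusterFinset (d : ℕ → ℕ) (i : ℕ) : Finset ℕ := Finset.Ico (start d i) (start d (i + 1))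

lemma coe_clusterFinset (d : ℕ → ℕ) (i : ℕ) : (clusterFinset d i : Set ℕ) = cluster d i :=
  Finset.coe_Ico _ _

lemma card_clusterFinset (d : ℕ → ℕ) (i : ℕ) : (clusterFinset d i).card = d i := by
  rw [clusterFinset, Nat.card_Ico, start_succ]; omega

lemma mem_clusterFinset {d : ℕ → ℕ} {i k : ℕ} :
    k ∈ clusterFinset d i ↔ start d i ≤ k ∧ k < start d (i + 1) := Finset.mem_Ico

lemma clusterSpan_eq (d : ℕ → ℕ) (u : ℕ → H) (i : ℕ) :
    clusterSpan d u i = Submodule.span ℝ (u '' (clusterFinset d i : Set ℕ)) := by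
  rw [coe_clusterFinset]; rfl

lemma clusterFinset_subset {d : ℕ → ℕ} {q i : ℕ} (hi : i < q) :
    clusterFinset d i ⊆ Finset.range (start d q) := by
  intro k hk
  exact Finset.mem_range.2 ((mem_clusterFinset.1 hk).2.trans_le (start_mono d hi))

lemma exists_mem_cluster (d : ℕ → ℕ) {q k : ℕ} (hk : k < start d q) :
    ∃ i < q, k ∈ clusterFinset d i := by
  induction q with
  | zero => simp [start] at hk
  | succ q ih =>
    rcases lt_or_ge k (start d q) with h | h
    · obtain ⟨i, hi, hki⟩ := ih h
      exact ⟨i, by omega, hki⟩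
    · exact ⟨q, by omega, mem_clusterFinset.2 ⟨h, hk⟩⟩

lemma eq_of_mem_clusterFinset {d : ℕ → ℕ} {i j k : ℕ} (hi : k ∈ clusterFinset d i)
    (hj : k ∈ clusterFinset d j) : i = j := by
  rw [mem_clusterFinset] at hi hj
  by_contra hne
  rcases Nat.lt_or_gt_of_ne hne with h | h
  · have := start_mono d (show i + 1 ≤ j from h); omega
  · have := start_mono d (show j + 1 ≤ i from h); omega

lemma sum_range_start {M : Type*} [AddCommMonoid M] (d : ℕ → ℕ) (q : ℕ) (f : ℕ → M) :
    ∑ k ∈ Finset.range (start d q), f k =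
      ∑ i ∈ Finset.range q, ∑ k ∈ clusterFinset d i, f k := by
  induction q with
  | zero => simp [start]
  | succ q ih =>
    rw [Finset.sum_range_succ, ← ih, clusterFinset, Finset.range_eq_Ico, Finset.range_eq_Ico,
      Finset.sum_Ico_consecutive _ (Nat.zero_le _) (start_mono d (Nat.le_succ q))]

section Gap

variable {V : Submodule ℝ H} {q : ℕ} {d : ℕ → ℕ} {m : ℕ} {lam : ℕ → ℝ} {u : ℕ → H}

lemma gap_le (h : OrderedEigenpairs a b V m lam u) (hm : start d q < m)
    {i r : ℕ} (hir : i < r) (hr : r ≤ q) :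
    gap q d lam ≤ lam (start d r) - lam (start d (i + 1) - 1) := by
  have h1 := start_mono d (show i + 1 ≤ r from hir)
  have h2 := start_mono d hr
  have h3 := h.le_of_le (show start d (i + 1) - 1 ≤ start d r by omega) (by omega)
  have h4 : gap q d lam ≤ |lam (start d (i + 1) - 1) - lam (start d r)| := by
    refine csInf_le ⟨0, ?_⟩ ⟨(i, r), ⟨hir, hr⟩, rfl⟩
    rintro _ ⟨p, -, rfl⟩
    exact abs_nonneg _
  rwa [abs_sub_comm, abs_of_nonneg (by linarith)] at h4

/-- Eigenvalues of different clusters, the rest of the spectrum included, differ by the gap. -/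
lemma gap_le_sub (h : OrderedEigenpairs a b V m lam u) (hm : start d q < m) {i k l : ℕ} (hi : i < q) (hk : k < start d (i + 1))
    (hl : start d (i + 1) ≤ l) (hlm : l < m) : gap q d lam ≤ lam l - lam k := by
  have h1 := gap_le h hm (Nat.lt_succ_self i) hi
  have h2 := h.le_of_le hl hlm
  have h3 := h.le_of_le (show k ≤ start d (i + 1) - 1 by omega) (by omega)
  linarith

lemma sub_le_spread (h : OrderedEigenpairs a b V m lam u) (hm : start d q < m) {i k l : ℕ}
    (hi : i < q) (hk : k ∈ clusterFinset d i) (hl : l ∈ clusterFinset d i) :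
    lam l - lam k ≤ spread q d lam := by
  have h1 : lam (start d (i + 1) - 1) - lam (start d i) ≤ spread q d lam :=
    le_csSup ((Set.finite_Iio q).image _).bddAbove ⟨i, hi, rfl⟩
  rw [mem_clusterFinset] at hk hl
  have h2 := start_mono d (show i + 1 ≤ q from hi)
  have h3 := h.le_of_le (show l ≤ start d (i + 1) - 1 by omega) (by omega)
  have h4 := h.le_of_le hk.1 (by omega)
  linarith

end Gap

/-! ### Perturbed Gram–Schmidt orthonormalization -/

/-- The growth of the error in the Gram–Schmidt process applied to `n` vectors that are nearly
orthonormal. -/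
noncomputable def gramSchmidtConst : ℕ → ℝ
  | 0 => 1
  | n + 1 => 2 * (1 + n * (1 + gramSchmidtConst n))

lemma one_le_gramSchmidtConst (n : ℕ) : 1 ≤ gramSchmidtConst n := by
  induction n with
  | zero => exact le_rfl
  | succ n ih =>
    have : (0 : ℝ) ≤ n * (1 + gramSchmidtConst n) := by positivity
    rw [gramSchmidtConst]; linarith

lemma gramSchmidtConst_le_succ (n : ℕ) : gramSchmidtConst n ≤ gramSchmidtConst (n + 1) := by
  have h := one_le_gramSchmidtConst n
  rw [gramSchmidtConst]
  rcases Nat.eq_zero_or_pos n with rfl | hn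
  · norm_num [gramSchmidtConst]
  · have : (1 : ℝ) ≤ n := by exact_mod_cast hn
    nlinarith

/-- Vectors `f k ∈ M k` close to an orthonormal family `x` can be replaced by an orthonormal
family `o k ∈ M k` close to `x`. Any two of the subspaces `M k` are equal or orthogonal, so the
Gram–Schmidt process does not leave them. -/
lemma exists_orthonormalFamily_near (hb : IsInnerForm b) {M : ℕ → Submodule ℝ H} {x f : ℕ → H}
    {τ : ℝ} (hτ : 0 ≤ τ) (n : ℕ) (hn : gramSchmidtConst n * τ ≤ 1)
    (hx : OrthonormalFamily b x (Finset.range n))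
    (hf : ∀ k < n, f k ∈ M k ∧ energyNorm b (x k - f k) ≤ τ)
    (hM : ∀ j < n, ∀ k < n, M j = M k ∨ ∀ v ∈ M j, ∀ w ∈ M k, b v w = 0) :
    ∃ o : ℕ → H, OrthonormalFamily b o (Finset.range n) ∧
      ∀ k < n, o k ∈ M k ∧ energyNorm b (o k - x k) ≤ gramSchmidtConst n * τ := by
  induction n with
  | zero => exact ⟨x, fun k hk => by simp at hk, fun k hk => by omega⟩
  | succ n ih =>
    have hK := mul_le_mul_of_nonneg_right (gramSchmidtConst_le_succ n) hτ
    obtain ⟨o, ho, hoM⟩ := ih (hK.trans hn)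
      (hx.mono (Finset.range_mono (Nat.le_succ n)))
      (fun k hk => hf k (by omega)) (fun j hj k hk => hM j (by omega) k (by omega))
    obtain ⟨hfn, hfx⟩ := hf n (Nat.lt_succ_self n)
    have hone : ∀ {v : H}, b v v = 1 → energyNorm b v = 1 := fun hv => by
      rw [energyNorm, hv, Real.sqrt_one]
    have ho1 : ∀ j < n, energyNorm b (o j) = 1 := fun j hj => hone (by
      rw [ho j (Finset.mem_range.2 hj) j (Finset.mem_range.2 hj), if_pos rfl])
    have hx1 : energyNorm b (x n) = 1 := hone (by
      rw [hx n (by simp) n (by simp), if_pos rfl])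
    set r := f n - ∑ j ∈ Finset.range n, b (f n) (o j) • o j with hr
    have hrM : r ∈ M n := by
      refine (M n).sub_mem hfn ((M n).sum_mem fun j hj => ?_)
      have hj' := Finset.mem_range.1 hj
      rcases hM n (Nat.lt_succ_self n) j (by omega) with h | h
      · rw [h]; exact (M j).smul_mem _ (hoM j hj').1
      · rw [h _ hfn _ (hoM j hj').1, zero_smul]; exact (M n).zero_mem
    have hrort : ∀ j < n, b r (o j) = 0 := fun j hj => by
      have := ho.part_apply subset_rfl (f n) (Finset.mem_range.2 hj)
      rw [if_pos (Finset.mem_range.2 hj), part] at this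
      rw [hr, map_sub, LinearMap.sub_apply, this, sub_self]
    have hcoef : ∀ j ∈ Finset.range n,
        energyNorm b (b (f n) (o j) • o j) ≤ (1 + gramSchmidtConst n) * τ := by
      intro j hj
      have hj' := Finset.mem_range.1 hj
      rw [IsInnerForm.energyNorm_smul, ho1 j hj', mul_one]
      have h0 : b (x n) (x j) = 0 := by
        rw [hx n (by simp) j (Finset.mem_range.2 (by omega)), if_neg (by omega)]
      have h1 : b (f n) (o j) = b (f n - x n) (o j) + b (x n) (o j - x j) := by
        simp only [map_sub, LinearMap.sub_apply, h0]; ring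
      have h2 := hb.abs_le (f n - x n) (o j)
      have h3 := hb.abs_le (x n) (o j - x j)
      rw [ho1 j hj', mul_one, IsInnerForm.energyNorm_sub_rev] at h2
      rw [hx1, one_mul] at h3
      rw [h1]
      refine (abs_add_le _ _).trans ?_
      linarith [(hoM j hj').2]
    have hdist : energyNorm b (r - x n) ≤ gramSchmidtConst (n + 1) * τ / 2 := by
      have h1 : r - x n = (f n - x n) + (-1 : ℝ) • ∑ j ∈ Finset.range n, b (f n) (o j) • o j := by
        rw [hr, neg_one_smul]; abel
      have h2 := hb.energyNorm_add_le (f n - x n)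
        ((-1 : ℝ) • ∑ j ∈ Finset.range n, b (f n) (o j) • o j)
      rw [← h1, IsInnerForm.energyNorm_smul, IsInnerForm.energyNorm_sub_rev b (f n)] at h2
      have h3 := (hb.energyNorm_sum_le (Finset.range n) fun j => b (f n) (o j) • o j).trans
        (Finset.sum_le_sum hcoef)
      rw [Finset.sum_const, Finset.card_range, nsmul_eq_mul] at h3
      rw [gramSchmidtConst]
      norm_num at h2
      linarith
    have hnorm := hb.abs_energyNorm_sub_le r (x n)
    rw [hx1] at hnorm
    have hrpos : 0 < energyNorm b r := by
      have := abs_sub_le_iff.1 hnorm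
      linarith
    set y := (energyNorm b r)⁻¹ • r with hy
    have hyy : b y y = 1 := by
      simp only [hy, map_smul, LinearMap.smul_apply, smul_eq_mul, ← hb.energyNorm_sq]
      field_simp
    have hyo : ∀ j < n, b y (o j) = 0 := fun j hj => by
      rw [hy, map_smul, LinearMap.smul_apply, hrort j hj, smul_zero]
    have hyr : energyNorm b (y - r) = |energyNorm b r - 1| := by
      have : y - r = ((energyNorm b r)⁻¹ - 1) • r := by rw [hy, sub_smul, one_smul]
      rw [this, IsInnerForm.energyNorm_smul]
      calc _ = |((energyNorm b r)⁻¹ - 1) * energyNorm b r| := by rw [abs_mul, abs_of_pos hrpos]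
        _ = _ := by rw [sub_mul, inv_mul_cancel₀ hrpos.ne', one_mul, abs_sub_comm]
    have hyx : energyNorm b (y - x n) ≤ gramSchmidtConst (n + 1) * τ := by
      have := hb.energyNorm_sub_le y r (x n)
      linarith
    refine ⟨Function.update o n y, ?_, ?_⟩
    · intro k hk l hl
      rw [Finset.mem_range] at hk hl
      rcases Nat.lt_succ_iff_lt_or_eq.1 hk with hk' | rfl <;>
        rcases Nat.lt_succ_iff_lt_or_eq.1 hl with hl' | hl'
      · rw [Function.update_of_ne hk'.ne, Function.update_of_ne hl'.ne]
        exact ho k (Finset.mem_range.2 hk') l (Finset.mem_range.2 hl')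
      · subst hl'
        rw [Function.update_of_ne hk'.ne, Function.update_self, hb.symm, hyo k hk',
          if_neg hk'.ne]
      · rw [Function.update_of_ne hl'.ne, Function.update_self, hyo l hl', if_neg hl'.ne']
      · subst hl'
        rw [Function.update_self, hyy, if_pos rfl]
    · intro k hk
      rcases Nat.lt_succ_iff_lt_or_eq.1 hk with hk' | rfl
      · rw [Function.update_of_ne hk'.ne]
        exact ⟨(hoM k hk').1, (hoM k hk').2.trans hK⟩
      · rw [Function.update_self]
        exact ⟨(M k).smul_mem _ hrM, hyx⟩

/-! ### Ritz values and Ritz vectors -/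

section Ritz

variable {V U : Submodule ℝ H} {m N : ℕ} {lam μ : ℕ → ℝ} {u x : ℕ → H} {δ : ℝ}

lemma OrderedEigenpairs.mul_apply_right_le (h : OrderedEigenpairs a b V m lam u)
    [FiniteDimensional ℝ V] (hm : Module.finrank ℝ V = m) (hb : IsInnerForm b) {v : H}
    (hv : v ∈ V) : lam 0 * b v v ≤ a v v := by
  rw [h.apply_right_eq hm hb hv, h.apply_left_eq hm hb hv hv, Finset.mul_sum]
  exact Finset.sum_le_sum fun k hk => mul_le_mul_of_nonneg_right
    (h.le_of_le (Nat.zero_le k) (Finset.mem_range.1 hk)) (mul_self_nonneg _)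

lemma OrderedEigenpairs.apply_sum_self (h : OrderedEigenpairs a b V m lam u) {S : Finset ℕ}
    (hS : S ⊆ Finset.range m) (c : ℕ → ℝ) :
    a (∑ k ∈ S, c k • u k) (∑ k ∈ S, c k • u k) = ∑ k ∈ S, lam k * c k ^ 2 := by
  have hmem : ∑ k ∈ S, c k • u k ∈ V := V.sum_mem fun k hk =>
    V.smul_mem _ (h.mem k (Finset.mem_range.1 (hS hk)))
  have key : ∀ y, a (∑ k ∈ S, c k • u k) y = ∑ k ∈ S, a (c k • u k) y := fun y => by
    rw [map_sum, LinearMap.sum_apply]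
  rw [key]
  refine Finset.sum_congr rfl fun k hk => ?_
  have h1 := h.eigen k (Finset.mem_range.1 (hS hk)) _ hmem
  have h2 : b (u k) (∑ k ∈ S, c k • u k) = c k := by
    simp only [map_sum, map_smul, smul_eq_mul]
    rw [Finset.sum_eq_single k]
    · rw [h.orthonormalFamily k (hS hk) k (hS hk), if_pos rfl, mul_one]
    · intro l hl hlk
      rw [h.orthonormalFamily k (hS hk) l (hS hl), if_neg hlk.symm, mul_zero]
    · intro h'; exact absurd hk h'
  rw [map_smul, LinearMap.smul_apply, h1, h2, smul_eq_mul]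
  ring

lemma OrderedEigenpairs.apply_part_self (h : OrderedEigenpairs a b V m lam u) {S : Finset ℕ}
    (hS : S ⊆ Finset.range m) (v : H) :
    a (part b u S v) (part b u S v) = ∑ k ∈ S, lam k * b v (u k) ^ 2 :=
  h.apply_sum_self hS _

/-- Ritz values are not below the eigenvalues. -/
lemma le_ritzValue (h : OrderedEigenpairs a b V m lam u) [FiniteDimensional ℝ V]
    (hm : Module.finrank ℝ V = m) (hb : IsInnerForm b) (hUV : U ≤ V)
    (hU : OrderedEigenpairs a b U N μ x) {k : ℕ} (hk : k < N) : lam k ≤ μ k := by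
  have hsub : Finset.range (k + 1) ⊆ Finset.range N := Finset.range_mono hk
  refine h.eigenvalue_le hm hb (x := x) (k := k)
    (fun j hj => hUV (hU.mem j (Finset.mem_range.1 (hsub hj)))) fun c => ?_
  have h1 := (hU.orthonormalFamily.mono hsub).sum_self c
  refine ⟨h1.ge, ?_⟩
  rw [h1, hU.apply_sum_self hsub, Finset.mul_sum]
  refine Finset.sum_le_sum fun j hj => mul_le_mul_of_nonneg_right ?_ (sq_nonneg _)
  exact hU.le_of_le (by simpa [Nat.lt_succ_iff] using hj) hk

/-- If the trial space is at distance `δ` from the first `N` eigenvectors, then the Ritz values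
exceed the eigenvalues by a factor `1 / (1 - δ²)` at most. -/
lemma mul_ritzValue_le (h : OrderedEigenpairs a b V m lam u) (ha : IsInnerForm a)
    (hb : IsInnerForm b) (hUV : U ≤ V)
    [FiniteDimensional ℝ U] (hNU : Module.finrank ℝ U = N)
    (hU : OrderedEigenpairs a b U N μ x) (hN : N ≤ m) (hδ : δ ^ 2 < 1)
    (hE : ∀ e ∈ Submodule.span ℝ (u '' (Finset.range N : Set ℕ)), ∃ v ∈ U,
      a (e - v) (e - v) ≤ δ ^ 2 * a e e) {k : ℕ} (hk : k < N) : (1 - δ ^ 2) * μ k ≤ lam k := by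
  have hNm : Finset.range N ⊆ Finset.range m := Finset.range_mono hN
  have hsub : Finset.range (k + 1) ⊆ Finset.range N := Finset.range_mono hk
  have hdim : Module.finrank ℝ U ≤
      Module.finrank ℝ (Submodule.span ℝ (u '' (Finset.range N : Set ℕ))) := by
    rw [(h.orthonormalFamily.mono hNm).finrank_span, Finset.card_range, hNU]
  obtain ⟨hs1, hs2⟩ := ha.dist_symm hdim hδ hE
  have hmem : ∀ j ∈ Finset.range N, u j ∈ Submodule.span ℝ (u '' (Finset.range N : Set ℕ)) :=
    fun j hj => Submodule.subset_span ⟨j, hj, rfl⟩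
  -- the trial vectors are those whose projections are the eigenvectors
  have hy : ∀ j, ∃ y, j ∈ Finset.range N → y ∈ U ∧
      ∀ f ∈ Submodule.span ℝ (u '' (Finset.range N : Set ℕ)), a (y - u j) f = 0 := by
    intro j
    by_cases hj : j ∈ Finset.range N
    · obtain ⟨y, hyU, hyo⟩ := hs2 _ (hmem j hj)
      exact ⟨y, fun _ => ⟨hyU, hyo⟩⟩
    · exact ⟨0, fun h => absurd h hj⟩
  choose y hy using hy
  have h1δ : 0 < 1 - δ ^ 2 := by linarith
  rw [mul_comm, ← le_div_iff₀ h1δ]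
  refine hU.eigenvalue_le hNU hb (x := y) (fun j hj => (hy j (hsub hj)).1) fun c => ?_
  set w := ∑ j ∈ Finset.range (k + 1), c j • y j with hw
  set v := ∑ j ∈ Finset.range (k + 1), c j • u j with hv
  have hwU : w ∈ U := U.sum_mem fun j hj => U.smul_mem _ (hy j (hsub hj)).1
  have hvE : v ∈ Submodule.span ℝ (u '' (Finset.range N : Set ℕ)) :=
    Submodule.sum_mem _ fun j hj => Submodule.smul_mem _ _ (hmem j (hsub hj))
  have hwv : ∀ f ∈ Submodule.span ℝ (u '' (Finset.range N : Set ℕ)), a (w - v) f = 0 := by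
    intro f hf
    rw [hw, hv, ← Finset.sum_sub_distrib]
    simp only [← smul_sub, map_sum, LinearMap.sum_apply, map_smul, LinearMap.smul_apply]
    exact Finset.sum_eq_zero fun j hj => by rw [(hy j (hsub hj)).2 f hf, smul_zero]
  have hvV : v ∈ V := h.span_le hNm hvE
  have hbwv : b (w - v) v = 0 := by
    rw [hv, map_sum]
    refine Finset.sum_eq_zero fun j hj => ?_
    have hj' := Finset.mem_range.1 (hNm (hsub hj))
    have h1 := h.eigen j hj' (w - v) (V.sub_mem (hUV hwU) hvV)
    rw [ha.symm, hwv _ (hmem j (hsub hj))] at h1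
    rw [map_smul, hb.symm, (mul_eq_zero.1 h1.symm).resolve_left (h.pos ha hj').ne', smul_zero]
  have hbw := hb.apply_eq_add_of_orthogonal hbwv
  have hbv : b v v = ∑ j ∈ Finset.range (k + 1), c j ^ 2 :=
    (h.orthonormalFamily.mono (hsub.trans hNm)).sum_self c
  have hbwv' := hb.nonneg (w - v)
  have haw := ha.apply_eq_add_of_orthogonal (hwv v hvE)
  have hav : a v v ≤ lam k * b v v := by
    rw [hbv, hv, h.apply_sum_self (hsub.trans hNm), Finset.mul_sum]
    refine Finset.sum_le_sum fun j hj => mul_le_mul_of_nonneg_right ?_ (sq_nonneg _)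
    exact h.le_of_le (by simpa [Nat.lt_succ_iff] using hj) (by omega)
  have hs := hs1 w hwU v hvE hwv
  have hlam := h.pos ha (show k < m by omega)
  refine ⟨by linarith, ?_⟩
  rw [div_mul_eq_mul_div, le_div_iff₀ h1δ]
  nlinarith

/-- A Ritz vector has a small component along each eigenvector whose eigenvalue is far from the
Ritz value. -/
lemma ritzVector_component_le (h : OrderedEigenpairs a b V m lam u) [FiniteDimensional ℝ V]
    (hm : Module.finrank ℝ V = m) (ha : IsInnerForm a)
    (hb : IsInnerForm b) (hUV : U ≤ V) [FiniteDimensional ℝ U]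
    (hU : OrderedEigenpairs a b U N μ x) (hN : N ≤ m)
    (hE : ∀ e ∈ Submodule.span ℝ (u '' (Finset.range N : Set ℕ)), ∃ v ∈ U,
      a (e - v) (e - v) ≤ δ ^ 2 * a e e) {k l : ℕ} (hk : k < N) (hl : l < N) :
    lam 0 * ((μ k - lam l) * b (x k) (u l)) ^ 2 ≤ μ k ^ 2 * (δ ^ 2 * lam l) := by
  obtain ⟨Q, hQ, hQo⟩ := ha.exists_projection U
  have hlV := h.mem l (hl.trans_le hN)
  have hxk := hU.mem k hk
  obtain ⟨v, hv, hle⟩ := hE (u l) (Submodule.subset_span ⟨l, Finset.mem_coe.2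
    (Finset.mem_range.2 hl), rfl⟩)
  have h1 := (ha.apply_sub_le_of_orthogonal (hQ (u l)) (hQo (u l)) hv).trans hle
  rw [h.apply_left_self (hl.trans_le hN)] at h1
  have h2 := hQo (u l) (x k) hxk
  have h3 := h.eigen l (hl.trans_le hN) (x k) (hUV hxk)
  have h4 := hU.eigen k hk _ (hQ (u l))
  have h5 : (μ k - lam l) * b (x k) (u l) = μ k * b (x k) (u l - Q (u l)) := by
    simp only [map_sub, LinearMap.sub_apply, ha.symm (Q (u l))] at h2
    rw [map_sub, hb.symm (x k) (u l)]
    linarith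
  have h6 := hb.sq_le (x k) (u l - Q (u l))
  rw [hU.orthonormal k hk k hk, if_pos rfl, one_mul] at h6
  have h7 := h.mul_apply_right_le hm hb (V.sub_mem hlV (hUV (hQ (u l))))
  have hpos := h.pos ha (show 0 < m by omega)
  rw [h5, mul_pow]
  have h8 : lam 0 * b (x k) (u l - Q (u l)) ^ 2 ≤ δ ^ 2 * lam l := by nlinarith
  nlinarith [mul_le_mul_of_nonneg_left h8 (sq_nonneg (μ k))]

end Ritz

/-! ### The estimate for the projected eigenvalue problem -/

lemma vecDist_le {o x : H} {r : ℝ} (hr : 0 ≤ r)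
    (h : energyNorm a (o - x) ≤ r * energyNorm a o) : vecDist a o x ≤ r := by
  refine IsInnerForm.subspaceDist_le hr fun v hv => ?_
  obtain ⟨t, rfl⟩ := Submodule.mem_span_singleton.1 hv
  refine ⟨t • x, Submodule.smul_mem _ _ (Submodule.mem_span_singleton_self x), ?_⟩
  rw [← smul_sub, IsInnerForm.energyNorm_smul, IsInnerForm.energyNorm_smul]
  nlinarith [mul_le_mul_of_nonneg_left h (abs_nonneg t)]

lemma IsInnerForm.exists_smul_of_vecDist_le (ha : IsInnerForm a) {o x : H} {r : ℝ}
    (h : vecDist a o x ≤ r) : ∃ t : ℝ, energyNorm a (o - t • x) ≤ r * energyNorm a o := by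
  obtain ⟨v, hv, hle⟩ := ha.exists_energyNorm_sub_le (V := Submodule.span ℝ {x})
    (Submodule.mem_span_singleton_self o)
  obtain ⟨t, rfl⟩ := Submodule.mem_span_singleton.1 hv
  exact ⟨t, hle.trans (mul_le_mul_of_nonneg_right h (energyNorm_nonneg _ _))⟩

/-- Bounds, up to the factor `Λ δ²`, the squared energy distance of a Ritz vector to the
eigenspace of its cluster; `N` is the number of eigenvalues and `κ` the relative gap. -/
noncomputable def leakConst (N : ℕ) (κ : ℝ) : ℝ := 1 + N * (4 / κ ^ 3)

/-- A constant in the estimate for the projected eigenvalue problem with `N` eigenvalues and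
relative gap `κ`. -/
noncomputable def projConst (N : ℕ) (κ : ℝ) : ℝ :=
  ((gramSchmidtConst N + 1) * √(leakConst N κ / κ) + √(leakConst N κ)) / √κ

lemma one_le_leakConst (N : ℕ) {κ : ℝ} (hκ : 0 < κ) : 1 ≤ leakConst N κ :=
  le_add_of_nonneg_right (by positivity)

lemma projConst_pos (N : ℕ) {κ : ℝ} (hκ : 0 < κ) : 0 < projConst N κ := by
  have h1 := one_le_leakConst N hκ
  have h2 := one_le_gramSchmidtConst N
  unfold projConst
  positivity

section Projected

variable {V U : Submodule ℝ H} {m q : ℕ} {d : ℕ → ℕ} {lam μ : ℕ → ℝ} {u x : ℕ → H} {δ κ : ℝ}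

lemma gap_le_top_sub (h : OrderedEigenpairs a b V m lam u) (hN : start d q < m) {k : ℕ}
    (hk : k < start d q) : gap q d lam ≤ lam (start d q) - lam k := by
  obtain ⟨i, hi, hki⟩ := exists_mem_cluster d hk
  exact gap_le_sub h hN hi (mem_clusterFinset.1 hki).2 (start_mono d hi) hN

/-- The Ritz values are quadratically close to the eigenvalues, with the constant `Λ = λ_{N+1}`,
and still lie below `Λ`. -/
lemma ritzValue_bounds (h : OrderedEigenpairs a b V m lam u) [FiniteDimensional ℝ V]
    (hm : Module.finrank ℝ V = m) (ha : IsInnerForm a) (hb : IsInnerForm b)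
    (hN : start d q < m) (hgap : κ * lam (start d q) ≤ gap q d lam)
    (hUV : U ≤ V) [FiniteDimensional ℝ U] (hNU : Module.finrank ℝ U = start d q)
    (hU : OrderedEigenpairs a b U (start d q) μ x) (hδ : δ ^ 2 < 1) (hδκ : δ ^ 2 ≤ κ)
    (hE : ∀ e ∈ Submodule.span ℝ (u '' (Finset.range (start d q) : Set ℕ)), ∃ v ∈ U,
      a (e - v) (e - v) ≤ δ ^ 2 * a e e) {k : ℕ} (hk : k < start d q) :
    lam k ≤ μ k ∧ μ k ≤ lam (start d q) ∧ μ k - lam k ≤ lam (start d q) * δ ^ 2 := by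
  have h1 := le_ritzValue h hm hb hUV hU hk
  have h2 := mul_ritzValue_le h ha hb hUV hNU hU hN.le hδ hE hk
  have h3 := gap_le_top_sub h hN hk
  have h4 := h.pos ha hN
  have h5 : μ k ≤ lam (start d q) := by
    have : (1 - δ ^ 2) * μ k ≤ (1 - δ ^ 2) * lam (start d q) := by nlinarith
    exact le_of_mul_le_mul_left this (by linarith)
  exact ⟨h1, h5, by nlinarith [mul_le_mul_of_nonneg_left h5 (sq_nonneg δ)]⟩

/-- A Ritz vector is close to the eigenspace of its cluster. -/
lemma ritzVector_residual_le (h : OrderedEigenpairs a b V m lam u) [FiniteDimensional ℝ V]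
    (hm : Module.finrank ℝ V = m) (ha : IsInnerForm a) (hb : IsInnerForm b)
    (hN : start d q < m) (hκ : 0 < κ) (hgap : κ * lam (start d q) ≤ gap q d lam)
    (hlow : κ * lam (start d q) ≤ lam 0)
    (hUV : U ≤ V) [FiniteDimensional ℝ U] (hNU : Module.finrank ℝ U = start d q)
    (hU : OrderedEigenpairs a b U (start d q) μ x) (hδ : δ ^ 2 < 1) (hδκ : δ ^ 2 ≤ κ / 2)
    (hE : ∀ e ∈ Submodule.span ℝ (u '' (Finset.range (start d q) : Set ℕ)), ∃ v ∈ U,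
      a (e - v) (e - v) ≤ δ ^ 2 * a e e) {i k : ℕ} (hi : i < q) (hk : k ∈ clusterFinset d i) :
    a (x k - part b u (clusterFinset d i) (x k)) (x k - part b u (clusterFinset d i) (x k)) ≤
      lam (start d q) * δ ^ 2 * leakConst (start d q) κ := by
  set Λ := lam (start d q) with hΛ
  set N := start d q with hNdef
  have hkN : k < N := Finset.mem_range.1 (clusterFinset_subset hi hk)
  have hNm : Finset.range N ⊆ Finset.range m := Finset.range_mono hN.le
  have hcl : clusterFinset d i ⊆ Finset.range N := clusterFinset_subset hi
  have hΛpos : 0 < Λ := h.pos ha hN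
  have hlam0 := h.pos ha (show 0 < m by omega)
  obtain ⟨hμ1, hμ2, hμ3⟩ := ritzValue_bounds h hm ha hb hN hgap hUV hNU hU hδ (by linarith) hE hkN
  have hxU := hU.mem k hkN
  -- the components along the other clusters
  have hcomp : ∀ l ∈ Finset.range N \ clusterFinset d i,
      lam l * b (x k) (u l) ^ 2 ≤ Λ * δ ^ 2 * (4 / κ ^ 3) := by
    intro l hl
    rw [Finset.mem_sdiff, Finset.mem_range] at hl
    obtain ⟨hlN, hli⟩ := hl
    have hsep : (κ * Λ / 2) ^ 2 ≤ (μ k - lam l) ^ 2 := by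
      have hκΛ : 0 ≤ κ * Λ / 2 := by positivity
      rw [mem_clusterFinset] at hk hli
      rcases lt_or_ge l (start d i) with hl' | hl'
      · obtain ⟨i', hi', hli'⟩ := exists_mem_cluster d hl'
        have h1 := gap_le_sub h hN (hi'.trans hi) (mem_clusterFinset.1 hli').2
          ((start_mono d hi').trans hk.1) (hkN.trans hN)
        exact pow_le_pow_left₀ hκΛ (by linarith) 2
      · have h1 := gap_le_sub h hN hi hk.2 (show start d (i + 1) ≤ l by omega) (hlN.trans hN)
        rw [← neg_sub, neg_sq]
        exact pow_le_pow_left₀ hκΛ (by nlinarith) 2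
    have h1 := ritzVector_component_le h hm ha hb hUV hU hN.le hE hkN hlN
    have hlΛ : lam l ≤ Λ := h.le_of_le hlN.le hN
    have hlpos := h.pos ha (hlN.trans hN)
    have hμpos : 0 < μ k := hU.pos ha hkN
    set β := b (x k) (u l) ^ 2 with hβ
    have hβ0 : 0 ≤ β := sq_nonneg _
    rw [mul_pow, ← hβ] at h1
    have h2 : κ * Λ * ((κ * Λ / 2) ^ 2 * β) ≤ Λ ^ 2 * (δ ^ 2 * Λ) := by
      calc κ * Λ * ((κ * Λ / 2) ^ 2 * β) ≤ lam 0 * ((μ k - lam l) ^ 2 * β) := by gcongr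
        _ ≤ μ k ^ 2 * (δ ^ 2 * lam l) := h1
        _ ≤ Λ ^ 2 * (δ ^ 2 * Λ) := by gcongr
    have h3 : β ≤ δ ^ 2 * (4 / κ ^ 3) := by
      have h4 : 0 < κ ^ 3 * Λ ^ 3 := by positivity
      rw [mul_div_assoc', le_div_iff₀ (by positivity)]
      have : Λ ^ 3 * (β * κ ^ 3) ≤ Λ ^ 3 * (δ ^ 2 * 4) := by nlinarith
      exact le_of_mul_le_mul_left this (by positivity)
    calc lam l * β ≤ Λ * (δ ^ 2 * (4 / κ ^ 3)) := by gcongr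
      _ = _ := by ring
  -- the component outside the first `N` eigenvectors
  have hdim : Module.finrank ℝ U ≤
      Module.finrank ℝ (Submodule.span ℝ (u '' (Finset.range N : Set ℕ))) := by
    rw [(h.orthonormalFamily.mono hNm).finrank_span, Finset.card_range, hNU]
  have hout := (ha.dist_symm hdim hδ hE).1 (x k) hxU _ (part_mem b u (Finset.range N) (x k))
    (fun f hf => h.sub_part_orthogonal ha hb hNm (hUV hxU) hf)
  rw [hU.apply_left_self hkN] at hout
  have hsplit : x k - part b u (clusterFinset d i) (x k) =
      (x k - part b u (Finset.range N) (x k)) +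
        part b u (Finset.range N \ clusterFinset d i) (x k) := by
    rw [part, part, part, ← Finset.sum_sdiff hcl]; abel
  have hsd : Finset.range N \ clusterFinset d i ⊆ Finset.range N := Finset.sdiff_subset
  rw [hsplit, ha.apply_add_of_orthogonal (h.sub_part_orthogonal ha hb hNm (hUV hxU)
    (Submodule.span_mono (Set.image_mono (by exact_mod_cast hsd)) (part_mem b u _ _))),
    h.apply_part_self (hsd.trans hNm)]
  have hsum := Finset.sum_le_sum hcomp
  rw [Finset.sum_const, nsmul_eq_mul] at hsum
  have hcard : ((Finset.range N \ clusterFinset d i).card : ℝ) ≤ N := by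
    have := Finset.card_le_card hsd
    rw [Finset.card_range] at this
    exact_mod_cast this
  have h6 := mul_le_mul_of_nonneg_right hcard (show 0 ≤ Λ * δ ^ 2 * (4 / κ ^ 3) by positivity)
  have h7 := mul_le_mul_of_nonneg_left hμ2 (sq_nonneg δ)
  rw [leakConst]
  linarith

lemma orthonormalBases_of_mem (h : OrderedEigenpairs a b V m lam u) (hN : start d q < m)
    {o : ℕ → H} (ho : OrthonormalFamily b o (Finset.range (start d q)))
    (hmem : ∀ i < q, ∀ k ∈ clusterFinset d i, o k ∈ clusterSpan d u i) :
    OrthonormalBases b q d u o where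
  orthonormal k hk l hl := ho k (Finset.mem_range.2 hk) l (Finset.mem_range.2 hl)
  span_eq i hi := by
    have hcl := clusterFinset_subset (d := d) hi
    have h2 := clusterSpan_eq d u i
    have h3 := clusterSpan_eq d o i
    rw [h2, h3]
    apply Submodule.eq_of_le_of_finrank_eq
    · rw [Submodule.span_le]
      rintro _ ⟨k, hk, rfl⟩
      rw [← h2]
      exact hmem i hi k hk
    · rw [(ho.mono hcl).finrank_span,
        (h.orthonormalFamily.mono (hcl.trans (Finset.range_mono hN.le))).finrank_span]

/-- The estimate for the projected eigenvalue problem holds with the constant `projConst`. The bases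
are obtained by orthonormalizing the projections of the Ritz vectors to the eigenspaces of their
clusters. -/
lemma projectionConstant (h : OrderedEigenpairs a b V m lam u) [FiniteDimensional ℝ V]
    (hm : Module.finrank ℝ V = m) (ha : IsInnerForm a) (hb : IsInnerForm b)
    (hN : start d q < m) (hκ : 0 < κ) (hgap : κ * lam (start d q) ≤ gap q d lam)
    (hlow : κ * lam (start d q) ≤ lam 0) {C c : ℝ} (hC : projConst (start d q) κ ≤ C)
    (hc1 : c ^ 2 < 1) (hc2 : c ^ 2 ≤ κ / 2)
    (hc3 : gramSchmidtConst (start d q) * (√(leakConst (start d q) κ / κ) * c) ≤ 1) :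
    ProjectionConstant a b V q d u C c := by
  intro U μ x hUV hNU hU hδc
  set N := start d q with hNdef
  set Λ := lam N with hΛ
  rw [← Finset.coe_range] at hδc ⊢
  set δ := subspaceDist a (Submodule.span ℝ (u '' (Finset.range N : Set ℕ))) U with hδdef
  have : FiniteDimensional ℝ U := Submodule.finiteDimensional_of_le hUV
  have hδ0 : 0 ≤ δ := IsInnerForm.subspaceDist_nonneg _ _ _
  have hδ2 : δ ^ 2 ≤ c ^ 2 := pow_le_pow_left₀ hδ0 hδc 2
  have hE : ∀ e ∈ Submodule.span ℝ (u '' (Finset.range N : Set ℕ)), ∃ v ∈ U,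
      a (e - v) (e - v) ≤ δ ^ 2 * a e e := fun e he => by
    obtain ⟨v, hv, hle⟩ := ha.exists_energyNorm_sub_le (V := U) he
    exact ⟨v, hv, (ha.energyNorm_le_mul_iff hδ0).1 hle⟩
  have hΛpos : 0 < Λ := h.pos ha hN
  have hlam0 := h.pos ha (show 0 < m by omega)
  have hNm : Finset.range N ⊆ Finset.range m := Finset.range_mono hN.le
  set B := leakConst N κ with hB
  have hB1 : 1 ≤ B := one_le_leakConst N hκ
  set K := gramSchmidtConst N with hK
  have hK1 : 1 ≤ K := one_le_gramSchmidtConst N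
  have hidx : ∀ k, ∃ i, k < N → i < q ∧ k ∈ clusterFinset d i := by
    intro k
    by_cases hk : k < N
    · obtain ⟨i, hi⟩ := exists_mem_cluster d hk
      exact ⟨i, fun _ => hi⟩
    · exact ⟨0, fun h => absurd h hk⟩
  choose idx hidx using hidx
  set f : ℕ → H := fun k => part b u (clusterFinset d (idx k)) (x k) with hf
  have hfM : ∀ k, f k ∈ clusterSpan d u (idx k) := fun k => by
    rw [clusterSpan_eq]; exact part_mem b u _ _
  have hclm : ∀ i < q, clusterFinset d i ⊆ Finset.range m := fun i hi =>
    (clusterFinset_subset hi).trans hNm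
  have hfV : ∀ k < N, f k ∈ V := fun k hk => h.part_mem (hclm _ (hidx k hk).1) (x k)
  have hxV : ∀ k < N, x k ∈ V := fun k hk => hUV (hU.mem k hk)
  have hres : ∀ k < N, a (x k - f k) (x k - f k) ≤ Λ * δ ^ 2 * B := fun k hk =>
    ritzVector_residual_le h hm ha hb hN hκ hgap hlow hUV hNU hU (hδ2.trans_lt hc1)
      (hδ2.trans hc2) hE (hidx k hk).1 (hidx k hk).2
  have hresa : ∀ k < N, energyNorm a (x k - f k) ≤ √Λ * (√B * δ) := fun k hk => by
    rw [energyNorm]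
    refine Real.sqrt_le_iff.2 ⟨by positivity, (hres k hk).trans (le_of_eq ?_)⟩
    rw [mul_pow, mul_pow, Real.sq_sqrt hΛpos.le, Real.sq_sqrt (by linarith)]
    ring
  have hresb : ∀ k < N, energyNorm b (x k - f k) ≤ √(B / κ) * δ := fun k hk => by
    rw [energyNorm]
    refine Real.sqrt_le_iff.2 ⟨by positivity, ?_⟩
    rw [mul_pow, Real.sq_sqrt (by positivity)]
    have h1 := h.mul_apply_right_le hm hb (V.sub_mem (hxV k hk) (hfV k hk))
    have h2 := hres k hk
    have h3 : κ * Λ * b (x k - f k) (x k - f k) ≤ Λ * δ ^ 2 * B :=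
      (mul_le_mul_of_nonneg_right hlow (hb.nonneg _)).trans (h1.trans h2)
    rw [div_mul_eq_mul_div, le_div_iff₀ hκ]
    refine le_of_mul_le_mul_left ?_ hΛpos
    linarith
  have hτ : 0 ≤ √(B / κ) * δ := by positivity
  have hKτ : K * (√(B / κ) * δ) ≤ 1 := by
    refine le_trans ?_ hc3
    gcongr
  obtain ⟨o, ho, hoM⟩ := exists_orthonormalFamily_near hb (M := fun k => clusterSpan d u (idx k))
    hτ N hKτ hU.orthonormalFamily (fun k hk => ⟨hfM k, hresb k hk⟩) (by
      intro j hj k hk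
      by_cases hjk : idx j = idx k
      · left; simp only [hjk]
      · right
        intro v hv w hw
        simp only [clusterSpan_eq] at hv hw
        have hj' := hidx j hj
        have hk' := hidx k hk
        rw [(h.orthonormalFamily.mono (hclm _ hk'.1)).eq_part hw, part, map_sum]
        refine Finset.sum_eq_zero fun l hl => ?_
        rw [map_smul, (h.orthonormalFamily.mono (hclm _ hj'.1)).eq_part hv,
          h.orthonormalFamily.part_apply (hclm _ hj'.1) v (hclm _ hk'.1 hl), if_neg, smul_zero]
        exact fun hl' => hjk (eq_of_mem_clusterFinset hl' hl))
  refine ⟨o, orthonormalBases_of_mem h hN ho ?_, fun k hk => ?_⟩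
  · intro i hi k hk
    have hkN := Finset.mem_range.1 (clusterFinset_subset hi hk)
    rw [eq_of_mem_clusterFinset hk (hidx k hkN).2]
    exact (hoM k hkN).1
  have hC0 := projConst_pos N hκ
  refine (vecDist_le (r := projConst N κ * δ) (by positivity) ?_).trans
    (mul_le_mul_of_nonneg_right hC hδ0)
  obtain ⟨hoMk, hox⟩ := hoM k hk
  have hoV : o k ∈ V := by
    simp only [clusterSpan_eq] at hoMk
    exact h.span_le (hclm _ (hidx k hk).1) hoMk
  -- the energy norm on the eigenspaces is bounded by `√Λ` times the norm of `b`
  have hof : energyNorm a (o k - f k) ≤ √Λ * energyNorm b (o k - f k) := by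
    have hmem := (clusterSpan d u (idx k)).sub_mem hoMk (hfM k)
    rw [clusterSpan_eq] at hmem
    have hS := hclm _ (hidx k hk).1
    have heq := (h.orthonormalFamily.mono hS).eq_part hmem
    rw [energyNorm, energyNorm, ← Real.sqrt_mul hΛpos.le]
    apply Real.sqrt_le_sqrt
    rw [heq, h.apply_part_self hS, part, (h.orthonormalFamily.mono hS).sum_self, Finset.mul_sum]
    exact Finset.sum_le_sum fun l hl => mul_le_mul_of_nonneg_right
      (h.le_of_le (Finset.mem_range.1 (clusterFinset_subset (hidx k hk).1 hl)).le hN)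
      (sq_nonneg _)
  have hofb := hb.energyNorm_sub_le (o k) (x k) (f k)
  have hoxa := ha.energyNorm_sub_le (o k) (f k) (x k)
  rw [IsInnerForm.energyNorm_sub_rev a (f k)] at hoxa
  have hoa : √κ * √Λ ≤ energyNorm a (o k) := by
    rw [← Real.sqrt_mul hκ.le, energyNorm]
    apply Real.sqrt_le_sqrt
    have h1 := h.mul_apply_right_le hm hb hoV
    rw [ho k (Finset.mem_range.2 hk) k (Finset.mem_range.2 hk), if_pos rfl, mul_one] at h1
    exact hlow.trans h1
  have h1 : energyNorm a (o k - x k) ≤ √Λ * (((K + 1) * √(B / κ) + √B) * δ) := by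
    have h2 : energyNorm b (o k - f k) ≤ (K + 1) * √(B / κ) * δ := by
      have := hresb k hk
      linarith
    have h3 := mul_le_mul_of_nonneg_left h2 (Real.sqrt_nonneg Λ)
    have h4 := hresa k hk
    linarith
  have h2 : √Λ * (((K + 1) * √(B / κ) + √B) * δ) = projConst N κ * δ * (√κ * √Λ) := by
    rw [projConst, ← hB, ← hK]
    have : 0 < √κ := Real.sqrt_pos.2 hκ
    field_simp
  rw [h2] at h1
  exact h1.trans (mul_le_mul_of_nonneg_left hoa (by positivity))

end Projected

/-! ### One step of shifted inverse iteration -/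

section Step

variable {V : Submodule ℝ H} {m : ℕ} {lam : ℕ → ℝ} {u : ℕ → H} {S : Finset ℕ}

lemma OrderedEigenpairs.apply_left_le_of_mem_span (h : OrderedEigenpairs a b V m lam u)
    (hS : S ⊆ Finset.range m) {lmax : ℝ} (hmax : ∀ k ∈ S, lam k ≤ lmax) {v : H}
    (hv : v ∈ Submodule.span ℝ (u '' S)) : a v v ≤ lmax * b v v := by
  rw [(h.orthonormalFamily.mono hS).eq_part hv, h.apply_part_self hS, part,
    (h.orthonormalFamily.mono hS).sum_self, Finset.mul_sum]
  exact Finset.sum_le_sum fun k hk => mul_le_mul_of_nonneg_right (hmax k hk) (sq_nonneg _)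

lemma OrderedEigenpairs.le_apply_left_of_mem_span (h : OrderedEigenpairs a b V m lam u)
    (hS : S ⊆ Finset.range m) {lmin : ℝ} (hmin : ∀ k ∈ S, lmin ≤ lam k) {v : H}
    (hv : v ∈ Submodule.span ℝ (u '' S)) : lmin * b v v ≤ a v v := by
  rw [(h.orthonormalFamily.mono hS).eq_part hv, h.apply_part_self hS, part,
    (h.orthonormalFamily.mono hS).sum_self, Finset.mul_sum]
  exact Finset.sum_le_sum fun k hk => mul_le_mul_of_nonneg_right (hmin k hk) (sq_nonneg _)

/-- If each vector of a `b`-orthonormal basis of an eigenspace with eigenvalues in `[lmin, lmax]`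
is at distance `ε` from the line through `y k`, then the eigenspace is at distance
`√(|S| lmax / lmin) ε` from the span of the `y k`. -/
lemma dist_span_le_of_vecDist_le (h : OrderedEigenpairs a b V m lam u) (ha : IsInnerForm a)
    (hS : S ⊆ Finset.range m) {lmin lmax : ℝ} (hl0 : 0 < lmin) (hmin : ∀ k ∈ S, lmin ≤ lam k)
    (hmax : ∀ k ∈ S, lam k ≤ lmax) {o y : ℕ → H} (ho : OrthonormalFamily b o S)
    (hspan : Submodule.span ℝ (o '' S) = Submodule.span ℝ (u '' S)) {ε : ℝ} (hε : 0 ≤ ε)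
    (hoy : ∀ k ∈ S, vecDist a (o k) (y k) ≤ ε) :
    ∀ e ∈ Submodule.span ℝ (u '' S), ∃ w ∈ Submodule.span ℝ (y '' S),
      a (e - w) (e - w) ≤ (S.card * (lmax / lmin) * ε ^ 2) * a e e := by
  intro e he
  have ht : ∀ k, ∃ t : ℝ, k ∈ S → energyNorm a (o k - t • y k) ≤ ε * energyNorm a (o k) := by
    intro k
    by_cases hk : k ∈ S
    · obtain ⟨t, ht⟩ := ha.exists_smul_of_vecDist_le (hoy k hk)
      exact ⟨t, fun _ => ht⟩
    · exact ⟨0, fun h => absurd h hk⟩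
  choose t ht using ht
  set c : ℕ → ℝ := fun k => b e (o k) with hc
  have hlow := h.le_apply_left_of_mem_span hS hmin he
  have heo : e = ∑ k ∈ S, c k • o k := ho.eq_part (by rwa [hspan])
  have hbe : b e e = ∑ k ∈ S, c k ^ 2 := by
    conv_lhs => rw [heo]
    exact ho.sum_self c
  refine ⟨∑ k ∈ S, c k • t k • y k, Submodule.sum_mem _ fun k hk => Submodule.smul_mem _ _
    (Submodule.smul_mem _ _ (Submodule.subset_span ⟨k, hk, rfl⟩)), ?_⟩
  have hdiff : e - ∑ k ∈ S, c k • t k • y k = ∑ k ∈ S, c k • (o k - t k • y k) := by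
    conv_lhs => rw [heo, ← Finset.sum_sub_distrib]
    simp only [smul_sub]
  have hono : ∀ k ∈ S, energyNorm a (o k) ≤ √lmax := fun k hk => by
    rw [energyNorm]
    apply Real.sqrt_le_sqrt
    have := h.apply_left_le_of_mem_span hS hmax (v := o k)
      (by rw [← hspan]; exact Submodule.subset_span ⟨k, hk, rfl⟩)
    rwa [ho k hk k hk, if_pos rfl, mul_one] at this
  have hnorm : energyNorm a (e - ∑ k ∈ S, c k • t k • y k) ≤ (∑ k ∈ S, |c k|) * (ε * √lmax) := by
    rw [hdiff, Finset.sum_mul]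
    refine (ha.energyNorm_sum_le _ _).trans (Finset.sum_le_sum fun k hk => ?_)
    rw [IsInnerForm.energyNorm_smul]
    gcongr
    exact (ht k hk).trans (mul_le_mul_of_nonneg_left (hono k hk) hε)
  rcases S.eq_empty_or_nonempty with rfl | ⟨k₀, hk₀⟩
  · simp [heo]
  have hlmax : 0 < lmax := hl0.trans_le ((hmin k₀ hk₀).trans (hmax k₀ hk₀))
  have hcs : (∑ k ∈ S, |c k|) ^ 2 ≤ S.card * (a e e / lmin) := by
    refine (sq_sum_le_card_mul_sum_sq).trans (mul_le_mul_of_nonneg_left ?_ (Nat.cast_nonneg _))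
    simp only [sq_abs]
    rw [← hbe, le_div_iff₀ hl0, mul_comm]
    exact hlow
  have hsq := pow_le_pow_left₀ (energyNorm_nonneg _ _) hnorm 2
  rw [ha.energyNorm_sq, mul_pow, mul_pow, Real.sq_sqrt hlmax.le] at hsq
  calc _ ≤ _ := hsq
    _ ≤ S.card * (a e e / lmin) * (ε ^ 2 * lmax) := by gcongr
    _ = _ := by ring

/-- Shifted inversion contracts the tangent of the angle between the eigenspace of a cluster and a
nearby space of the same dimension by the factor `η / G`, where `η` bounds the distances of the
shift to the eigenvalues of the cluster from above and `G` those to the other eigenvalues from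
below. -/
lemma dist_span_le_of_shiftedInverse (h : OrderedEigenpairs a b V m lam u)
    [FiniteDimensional ℝ V] (hm : Module.finrank ℝ V = m) (ha : IsInnerForm a)
    (hb : IsInnerForm b) (hS : S ⊆ Finset.range m) {y z : ℕ → H} (hy : ∀ k ∈ S, y k ∈ V)
    (hz : ∀ k ∈ S, z k ∈ V) {σ η G s : ℝ} (hσ : σ ≠ 0) (hη : ∀ l ∈ S, |lam l - σ| ≤ η)
    (hG : 0 < G) (hGl : ∀ l ∈ Finset.range m, l ∉ S → G ≤ |lam l - σ|)
    (hreg : ∀ l ∈ Finset.range m, lam l ≠ σ)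
    (hyz : ∀ k ∈ S, ∀ v ∈ V, a (z k) v - σ * b (z k) v = σ * b (y k) v)
    (hs : s ^ 2 < 1)
    (hdist : ∀ e ∈ Submodule.span ℝ (u '' S), ∃ w ∈ Submodule.span ℝ (y '' S),
      a (e - w) (e - w) ≤ s ^ 2 * a e e) :
    ∀ e ∈ Submodule.span ℝ (u '' S), ∃ v ∈ Submodule.span ℝ (z '' S),
      a (e - v) (e - v) ≤ η ^ 2 * s ^ 2 / (G ^ 2 * (1 - s ^ 2) + η ^ 2 * s ^ 2) * a e e := by
  classical
  intro e he
  have hoS := h.orthonormalFamily.mono hS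
  have hdim : Module.finrank ℝ (Submodule.span ℝ (y '' (S : Set ℕ))) ≤
      Module.finrank ℝ (Submodule.span ℝ (u '' (S : Set ℕ))) := by
    rw [hoS.finrank_span, ← Finset.coe_image]
    exact (finrank_span_finset_le_card _).trans Finset.card_image_le
  obtain ⟨hs1, hs2⟩ := ha.dist_symm hdim hs hdist
  set e' : H := ∑ l ∈ S, ((lam l - σ) * b e (u l)) • u l with he'
  have he'M : e' ∈ Submodule.span ℝ (u '' (S : Set ℕ)) := Submodule.sum_mem _ fun k hk =>
    Submodule.smul_mem _ _ (Submodule.subset_span ⟨k, hk, rfl⟩)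
  obtain ⟨w, hw, hwo⟩ := hs2 e' he'M
  have hx := hs1 w hw e' he'M hwo
  set x := w - e' with hxdef
  have hpyth := ha.apply_eq_add_of_orthogonal (hwo e' he'M)
  rw [← hxdef] at hpyth
  rw [hpyth] at hx
  have hee : a e e = ∑ l ∈ S, lam l * b e (u l) ^ 2 := by
    conv_lhs => rw [hoS.eq_part he]
    exact h.apply_part_self hS e
  have hae' : a e' e' ≤ η ^ 2 * a e e := by
    rw [he', h.apply_sum_self hS, hee, Finset.mul_sum]
    refine Finset.sum_le_sum fun l hl => ?_
    have h1 : (lam l - σ) ^ 2 ≤ η ^ 2 := by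
      rw [← sq_abs]; exact pow_le_pow_left₀ (abs_nonneg _) (hη l hl) 2
    have h2 : 0 ≤ lam l * b e (u l) ^ 2 :=
      mul_nonneg (h.pos ha (Finset.mem_range.1 (hS hl))).le (sq_nonneg _)
    nlinarith [mul_le_mul_of_nonneg_right h1 h2]
  obtain ⟨c, hcw⟩ := (Submodule.mem_span_image_finset_iff_exists_fun' ℝ).1 hw
  set Z : H := σ⁻¹ • ∑ k ∈ S, c k • z k with hZ
  have hwV : w ∈ V := by
    rw [← hcw]; exact V.sum_mem fun k hk => V.smul_mem _ (hy k hk)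
  have hZV : Z ∈ V := V.smul_mem _ (V.sum_mem fun k hk => V.smul_mem _ (hz k hk))
  have heV : e ∈ V := h.span_le hS he
  have he'V : e' ∈ V := h.span_le hS he'M
  have hxV : x ∈ V := V.sub_mem hwV he'V
  have hZw : ∀ l ∈ Finset.range m, (lam l - σ) * b Z (u l) = b w (u l) := by
    intro l hl
    have hl' := Finset.mem_range.1 hl
    have h1 : ∀ k ∈ S, (lam l - σ) * b (z k) (u l) = σ * b (y k) (u l) := fun k hk => by
      have h2 := hyz k hk (u l) (h.mem l hl')
      have h3 := h.eigen l hl' (z k) (hz k hk)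
      rw [ha.symm, hb.symm] at h3
      rw [← h2, h3]; ring
    rw [hZ, ← hcw]
    simp only [map_sum, LinearMap.sum_apply, map_smul, LinearMap.smul_apply, smul_eq_mul,
      Finset.mul_sum]
    refine Finset.sum_congr rfl fun k hk => ?_
    have := h1 k hk
    calc _ = σ⁻¹ * c k * ((lam l - σ) * b (z k) (u l)) := by ring
      _ = _ := by rw [this]; field_simp
  have he'l : ∀ l ∈ Finset.range m, b e' (u l) = if l ∈ S then (lam l - σ) * b e (u l) else 0 :=
    fun l hl => h.orthonormalFamily.sum_apply hS (fun l => (lam l - σ) * b e (u l)) hl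
  have hel : ∀ l ∈ Finset.range m, l ∉ S → b e (u l) = 0 := fun l hl hlS => by
    rw [hoS.eq_part he, h.orthonormalFamily.part_apply hS e hl, if_neg hlS]
  have hxl : ∀ l ∈ S, b x (u l) = 0 := fun l hl => by
    have hl' := Finset.mem_range.1 (hS hl)
    have h1 := h.eigen l hl' x hxV
    rw [ha.symm, hwo _ (Submodule.subset_span ⟨l, hl, rfl⟩)] at h1
    rw [hb.symm]
    exact (mul_eq_zero.1 h1.symm).resolve_left (h.pos ha hl').ne'
  have hyS : ∀ l ∈ S, b (Z - e) (u l) = 0 := by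
    intro l hl
    have h1 := hZw l (hS hl)
    have h2 := hxl l hl
    rw [hxdef, map_sub, LinearMap.sub_apply, he'l l (hS hl), if_pos hl, ← h1, ← mul_sub] at h2
    rw [map_sub, LinearMap.sub_apply]
    exact (mul_eq_zero.1 h2).resolve_left (sub_ne_zero.2 (hreg l (hS hl)))
  have hyle : ∀ l ∈ Finset.range m, G ^ 2 * b (Z - e) (u l) ^ 2 ≤ b x (u l) ^ 2 := by
    intro l hl
    by_cases hlS : l ∈ S
    · rw [hyS l hlS]; simpa using sq_nonneg _
    · have h1 := hZw l hl
      rw [hxdef, map_sub, map_sub, LinearMap.sub_apply, LinearMap.sub_apply, hel l hl hlS,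
        he'l l hl, if_neg hlS, sub_zero, sub_zero, ← h1, mul_pow]
      refine mul_le_mul_of_nonneg_right ?_ (sq_nonneg _)
      rw [← sq_abs (lam l - σ)]
      exact pow_le_pow_left₀ hG.le (hGl l hl hlS) 2
  have hyx : G ^ 2 * a (Z - e) (Z - e) ≤ a x x := by
    rw [h.apply_left_eq hm hb hxV hxV,
      h.apply_left_eq hm hb (V.sub_mem hZV heV) (V.sub_mem hZV heV), Finset.mul_sum]
    refine Finset.sum_le_sum fun l hl => ?_
    have := mul_le_mul_of_nonneg_left (hyle l hl) (h.pos ha (Finset.mem_range.1 hl)).le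
    nlinarith
  have hort : a e (Z - e) = 0 := by
    rw [ha.symm]
    exact h.apply_left_eq_zero ha hb hS (V.sub_mem hZV heV) hyS he
  have h1s : 0 < 1 - s ^ 2 := by linarith
  have hτ : a (Z - e) (Z - e) ≤ (η * s / (G * √(1 - s ^ 2))) ^ 2 * a e e := by
    rw [div_pow, mul_pow, mul_pow, Real.sq_sqrt h1s.le, div_mul_eq_mul_div,
      le_div_iff₀ (by positivity)]
    have h1 : (1 - s ^ 2) * a x x ≤ s ^ 2 * a e' e' := by linarith
    have h2 := mul_le_mul_of_nonneg_left hae' (sq_nonneg s)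
    have h3 := mul_le_mul_of_nonneg_right hyx h1s.le
    linarith
  obtain ⟨t, ht⟩ := ha.exists_smul_close hort hτ
  rw [add_sub_cancel] at ht
  refine ⟨t • Z, Submodule.smul_mem _ _ (Submodule.smul_mem _ _ (Submodule.sum_mem _ fun k hk =>
    Submodule.smul_mem _ _ (Submodule.subset_span ⟨k, hk, rfl⟩))), ht.trans (le_of_eq ?_)⟩
  congr 1
  rw [div_pow, mul_pow, mul_pow, Real.sq_sqrt h1s.le]
  field_simp

/-- Distances of the individual clusters add up in the mean square. -/
lemma dist_span_le_of_clusters (h : OrderedEigenpairs a b V m lam u) (ha : IsInnerForm a)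
    {q : ℕ} {d : ℕ → ℕ} (hN : start d q < m) {Z : Submodule ℝ H} {β : ℝ} (hβ : 0 ≤ β)
    (hZ : ∀ i < q, ∀ e ∈ Submodule.span ℝ (u '' (clusterFinset d i : Set ℕ)), ∃ v ∈ Z,
      a (e - v) (e - v) ≤ d i * β ^ 2 * a e e) :
    ∀ e ∈ Submodule.span ℝ (u '' (Finset.range (start d q) : Set ℕ)), ∃ v ∈ Z,
      a (e - v) (e - v) ≤ start d q * β ^ 2 * a e e := by
  intro e he
  have hNm : Finset.range (start d q) ⊆ Finset.range m := Finset.range_mono hN.le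
  have hv : ∀ i, ∃ v, i ∈ Finset.range q → v ∈ Z ∧
      energyNorm a (part b u (clusterFinset d i) e - v) ≤
        √(d i) * energyNorm a (part b u (clusterFinset d i) e) * β := by
    intro i
    by_cases hi : i < q
    · obtain ⟨v, hv, hle⟩ := hZ i hi _ (part_mem b u (clusterFinset d i) e)
      refine ⟨v, fun _ => ⟨hv, ?_⟩⟩
      have := (ha.energyNorm_le_mul_iff (r := √(d i) * β) (by positivity)).2 (by
        rw [mul_pow, Real.sq_sqrt (Nat.cast_nonneg _)]; exact hle)
      linarith
    · exact ⟨0, fun h => absurd (Finset.mem_range.1 h) hi⟩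
  choose v hv using hv
  refine ⟨∑ i ∈ Finset.range q, v i, Z.sum_mem fun i hi => (hv i hi).1, ?_⟩
  have hoN := h.orthonormalFamily.mono hNm
  have hsum : e = ∑ i ∈ Finset.range q, part b u (clusterFinset d i) e := by
    conv_lhs => rw [hoN.eq_part he, part, sum_range_start]
    rfl
  have hae : a e e = ∑ i ∈ Finset.range q,
      energyNorm a (part b u (clusterFinset d i) e) ^ 2 := by
    conv_lhs => rw [hoN.eq_part he, h.apply_part_self hNm, sum_range_start]
    refine Finset.sum_congr rfl fun i hi => ?_
    rw [ha.energyNorm_sq, h.apply_part_self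
      ((clusterFinset_subset (Finset.mem_range.1 hi)).trans hNm)]
  have hnorm : energyNorm a (e - ∑ i ∈ Finset.range q, v i) ≤
      (∑ i ∈ Finset.range q, √(d i) * energyNorm a (part b u (clusterFinset d i) e)) * β := by
    conv_lhs => rw [hsum, ← Finset.sum_sub_distrib]
    rw [Finset.sum_mul]
    exact (ha.energyNorm_sum_le _ _).trans (Finset.sum_le_sum fun i hi => (hv i hi).2)
  have hcs := Finset.sum_mul_sq_le_sq_mul_sq (Finset.range q) (fun i => √(d i : ℝ))
    (fun i => energyNorm a (part b u (clusterFinset d i) e))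
  have hd : ∑ i ∈ Finset.range q, √(d i : ℝ) ^ 2 = start d q := by
    rw [start, Nat.cast_sum]
    exact Finset.sum_congr rfl fun i _ => Real.sq_sqrt (Nat.cast_nonneg _)
  rw [hd, ← hae] at hcs
  have hsq := pow_le_pow_left₀ (energyNorm_nonneg _ _) hnorm 2
  rw [ha.energyNorm_sq, mul_pow] at hsq
  nlinarith [mul_le_mul_of_nonneg_right hcs (sq_nonneg β)]

end Step

/-- Compares the contraction of a single cluster of dimension `n` with the common bound. -/
lemma contraction_le {K n D x η G : ℝ} (hx : 0 ≤ x) (hn : 1 ≤ n) (hD : 0 ≤ D)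
    (hK0 : 0 ≤ K) (hDx : D * x < 1) (hKx : K * x < 1) (hG : 0 < G)
    (hK : K * (1 + (n - 1) * (D * x)) ≤ n * D) :
    η ^ 2 * (K * x) / (G ^ 2 * (1 - K * x) + η ^ 2 * (K * x)) ≤
      n * (D * η ^ 2 * x / (G ^ 2 * (1 - D * x) + D * η ^ 2 * x)) := by
  have h1 : 0 < G ^ 2 * (1 - K * x) := by have : 0 < 1 - K * x := by linarith
                                          positivity
  have h2 : 0 < G ^ 2 * (1 - D * x) := by have : 0 < 1 - D * x := by linarith
                                          positivity
  have h3 : 0 ≤ η ^ 2 * (K * x) := by positivity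
  have h4 : 0 ≤ D * η ^ 2 * x := by positivity
  rw [mul_div_assoc', div_le_div_iff₀ (by linarith) (by linarith)]
  have h5 := mul_le_mul_of_nonneg_left hK (show 0 ≤ G ^ 2 * (η ^ 2 * x) by positivity)
  have h6 : 0 ≤ (n - 1) * (η ^ 2 * x) ^ 2 * (K * D) := by
    have : 0 ≤ n - 1 := by linarith
    positivity
  linarith

/-! ### The shifts -/

section Shift

variable {q : ℕ} {d : ℕ → ℕ} {w : ℕ → ℕ → ℝ} {lam l : ℕ → ℝ} {i : ℕ}

lemma mem_clusterFinset_add (d : ℕ → ℕ) (i : ℕ) {j : ℕ} (hj : j ∈ Finset.range (d i)) :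
    start d i + j ∈ clusterFinset d i := by
  rw [mem_clusterFinset, start_succ]
  have := Finset.mem_range.1 hj
  omega

lemma abs_sub_shift_le (hw : ConvexWeights q d w) (hi : i < q) {x r : ℝ}
    (h : ∀ k ∈ clusterFinset d i, |x - lam k| ≤ r) : |x - shift d w lam i| ≤ r := by
  obtain ⟨hw0, hw1⟩ := hw i hi
  have h1 : x - shift d w lam i =
      ∑ j ∈ Finset.range (d i), w i j * (x - lam (start d i + j)) := by
    simp only [mul_sub, Finset.sum_sub_distrib]
    rw [← Finset.sum_mul, hw1, one_mul]; rfl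
  rw [h1, ← one_mul r, ← hw1, Finset.sum_mul]
  refine (Finset.abs_sum_le_sum_abs _ _).trans (Finset.sum_le_sum fun j hj => ?_)
  have h2 := hw0 j (Finset.mem_range.1 hj)
  rw [abs_mul, abs_of_nonneg h2]
  exact mul_le_mul_of_nonneg_left (h _ (mem_clusterFinset_add d i hj)) h2

lemma abs_shift_sub_shift_le (hw : ConvexWeights q d w) (hi : i < q) {r : ℝ}
    (h : ∀ k ∈ clusterFinset d i, |lam k - l k| ≤ r) :
    |shift d w lam i - shift d w l i| ≤ r := by
  obtain ⟨hw0, hw1⟩ := hw i hi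
  have h1 : shift d w lam i - shift d w l i =
      ∑ j ∈ Finset.range (d i), w i j * (lam (start d i + j) - l (start d i + j)) := by
    simp only [mul_sub, Finset.sum_sub_distrib]; rfl
  rw [h1, ← one_mul r, ← hw1, Finset.sum_mul]
  refine (Finset.abs_sum_le_sum_abs _ _).trans (Finset.sum_le_sum fun j hj => ?_)
  have h2 := hw0 j (Finset.mem_range.1 hj)
  rw [abs_mul, abs_of_nonneg h2]
  exact mul_le_mul_of_nonneg_left (h _ (mem_clusterFinset_add d i hj)) h2

lemma shift_le (hw : ConvexWeights q d w) (hi : i < q) {r : ℝ}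
    (h : ∀ k ∈ clusterFinset d i, lam k ≤ r) : shift d w lam i ≤ r := by
  obtain ⟨hw0, hw1⟩ := hw i hi
  rw [← one_mul r, ← hw1, Finset.sum_mul]
  exact Finset.sum_le_sum fun j hj => mul_le_mul_of_nonneg_left
    (h _ (mem_clusterFinset_add d i hj)) (hw0 j (Finset.mem_range.1 hj))

lemma le_shift (hw : ConvexWeights q d w) (hi : i < q) {r : ℝ}
    (h : ∀ k ∈ clusterFinset d i, r ≤ lam k) : r ≤ shift d w lam i := by
  obtain ⟨hw0, hw1⟩ := hw i hi
  rw [← one_mul r, ← hw1, Finset.sum_mul]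
  exact Finset.sum_le_sum fun j hj => mul_le_mul_of_nonneg_left
    (h _ (mem_clusterFinset_add d i hj)) (hw0 j (Finset.mem_range.1 hj))

lemma abs_shift_sub_shift_le_shiftError (hi : i < q) :
    |shift d w lam i - shift d w l i| ≤ shiftError q d w lam l :=
  le_csSup ((Set.finite_Iio q).image _).bddAbove ⟨i, hi, rfl⟩

end Shift

/-! ### The distance after one iteration -/

section Iteration

variable {V : Submodule ℝ H} {m q : ℕ} {d : ℕ → ℕ} {lam l l' : ℕ → ℝ} {u y z y' : ℕ → H}
  {w : ℕ → ℕ → ℝ} {D ε ζ : ℝ}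

lemma spread_nonneg (h : OrderedEigenpairs a b V m lam u) (hq : 0 < q) (hd : ∀ i < q, 0 < d i)
    (hN : start d q < m) : 0 ≤ spread q d lam := by
  have hmem : start d 0 ∈ clusterFinset d 0 := mem_clusterFinset.2
    ⟨le_rfl, by rw [start_succ]; have := hd 0 hq; omega⟩
  have := sub_le_spread h hN hq hmem hmem
  linarith

/-- The span of the shifted-inverse iterates is at distance `ε' / C` from the sum of the first `q`
eigenspaces, where `ε'` is the next value of the recursion for the error bounds. -/
lemma subspaceDist_shiftedInverse_le (h : OrderedEigenpairs a b V m lam u)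
    [FiniteDimensional ℝ V] (hm : Module.finrank ℝ V = m) (ha : IsInnerForm a)
    (hb : IsInnerForm b) (hq : 0 < q) (hd : ∀ i < q, 0 < d i) (hN : start d q < m)
    (hw : ConvexWeights q d w) (hdD : ∀ i < q, (d i : ℝ) ≤ D)
    (hy : ∀ k < start d q, y k ∈ V) (hreg : ShiftsRegular q d w m lam l)
    (hstep : ShiftedInverseStep a b V q d w l y z l' y')
    (hζ : ∀ i < q, |shift d w lam i - shift d w l i| ≤ ζ)
    {o : ℕ → H} (ho : OrthonormalBases b q d u o) (hε : 0 ≤ ε)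
    (hoy : ∀ k < start d q, vecDist a (o k) (y k) ≤ ε)
    (hDε : D ^ 2 * ε ^ 2 ≤ 1 / 4) (hγ : spread q d lam ≤ lam 0 / 4) (hζ0 : ζ < lam 0)
    (hG : 0 < gap q d lam - spread q d lam - ζ) :
    subspaceDist a (Submodule.span ℝ (u '' (Finset.range (start d q) : Set ℕ)))
        (Submodule.span ℝ (z '' Set.Iio (start d q))) ≤
      √(D * start d q) * (spread q d lam + ζ) * ε /
        √((gap q d lam - spread q d lam - ζ) ^ 2 * (1 - D * ε ^ 2) +
          D * (spread q d lam + ζ) ^ 2 * ε ^ 2) := by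
  set N := start d q with hNdef
  set γ := spread q d lam with hγdef
  set g := gap q d lam with hgdef
  have hγ0 : 0 ≤ γ := spread_nonneg h hq hd hN
  have hζnn : 0 ≤ ζ := (abs_nonneg _).trans (hζ 0 hq)
  have hD1 : 1 ≤ D := le_trans (by exact_mod_cast hd 0 hq) (hdD 0 hq)
  have hε2 : 0 ≤ ε ^ 2 := sq_nonneg ε
  have hDx : D * ε ^ 2 ≤ 1 / 4 := by nlinarith
  have hNm : Finset.range N ⊆ Finset.range m := Finset.range_mono hN.le
  have hlam0 : 0 < lam 0 := h.pos ha (by omega)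
  set G := g - γ - ζ with hGdef
  set η := γ + ζ with hη
  have hden : 0 < G ^ 2 * (1 - D * ε ^ 2) + D * η ^ 2 * ε ^ 2 := by
    have h1 : 0 < G ^ 2 * (1 - D * ε ^ 2) := mul_pos (pow_pos hG 2) (by linarith)
    have h2 : 0 ≤ D * η ^ 2 * ε ^ 2 := by positivity
    linarith
  set β := √(D * η ^ 2 * ε ^ 2 / (G ^ 2 * (1 - D * ε ^ 2) + D * η ^ 2 * ε ^ 2)) with hβ
  have hβ2 : β ^ 2 = D * η ^ 2 * ε ^ 2 / (G ^ 2 * (1 - D * ε ^ 2) + D * η ^ 2 * ε ^ 2) :=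
    Real.sq_sqrt (div_nonneg (by positivity) hden.le)
  have hcluster : ∀ i < q, ∀ e ∈ Submodule.span ℝ (u '' (clusterFinset d i : Set ℕ)),
      ∃ v ∈ Submodule.span ℝ (z '' Set.Iio N),
        a (e - v) (e - v) ≤ d i * β ^ 2 * a e e := by
    intro i hi e he
    have hcl := clusterFinset_subset (d := d) hi
    have hS := hcl.trans hNm
    have hlt : ∀ k ∈ clusterFinset d i, k < N := fun k hk => Finset.mem_range.1 (hcl hk)
    have hdi := hd i hi
    have hsucc := start_succ d i
    have hfirst : start d i ∈ clusterFinset d i := mem_clusterFinset.2 ⟨le_rfl, by omega⟩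
    have hlast : start d (i + 1) - 1 ∈ clusterFinset d i := mem_clusterFinset.2 ⟨by omega, by omega⟩
    set lmin := lam (start d i) with hlmin
    set lmax := lam (start d (i + 1) - 1) with hlmax
    have hminpos : 0 < lmin := h.pos ha ((hlt _ hfirst).trans hN)
    have hmin : ∀ k ∈ clusterFinset d i, lmin ≤ lam k := fun k hk =>
      h.le_of_le (mem_clusterFinset.1 hk).1 ((hlt k hk).trans hN)
    have hmax : ∀ k ∈ clusterFinset d i, lam k ≤ lmax := fun k hk =>
      h.le_of_le (by have := (mem_clusterFinset.1 hk).2; omega) ((hlt _ hlast).trans hN)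
    have hminmax := hmax _ hfirst
    have h0min : lam 0 ≤ lmin := h.le_of_le (Nat.zero_le _) ((hlt _ hfirst).trans hN)
    have hspr : lmax - lmin ≤ γ := sub_le_spread h hN hi hfirst hlast
    -- `K ε²` bounds the squared sine of the angle between the eigenspace and the approximations
    set K : ℝ := d i * (lmax / lmin) with hK
    have hdi1 : (1 : ℝ) ≤ d i := by exact_mod_cast hdi
    have hratio : lmax / lmin ≤ 5 / 4 := by
      rw [div_le_iff₀ hminpos]; linarith
    have hratio0 : 0 ≤ lmax / lmin := div_nonneg (by linarith) hminpos.le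
    have hK0 : 0 ≤ K := by positivity
    have hKd : K ≤ d i * (5 / 4) := mul_le_mul_of_nonneg_left hratio (by linarith)
    have hKx : K * ε ^ 2 < 1 := by
      have : K * ε ^ 2 ≤ D * (5 / 4) * ε ^ 2 := by
        gcongr
        linarith [hdD i hi]
      linarith
    -- for a simple eigenvalue `K = 1`; otherwise `d i ≤ d i * D / 2` leaves room for `lmax / lmin`
    have hKcond : K * (1 + (d i - 1) * (D * ε ^ 2)) ≤ d i * D := by
      rcases Nat.lt_or_ge 1 (d i) with h2 | h2
      · have h2' : (2 : ℝ) ≤ d i := by exact_mod_cast h2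
        have h3 : ((d i : ℝ) - 1) * (D * ε ^ 2) ≤ 1 / 4 := by
          calc ((d i : ℝ) - 1) * (D * ε ^ 2) ≤ D * (D * ε ^ 2) := by
                gcongr; linarith [hdD i hi]
            _ = D ^ 2 * ε ^ 2 := by ring
            _ ≤ _ := hDε
        have h4 : K * (1 + (d i - 1) * (D * ε ^ 2)) ≤ d i * (5 / 4) * (1 + 1 / 4) := by
          gcongr
        have h5 : (d i : ℝ) * 2 ≤ d i * D := by
          gcongr; linarith [hdD i hi]
        linarith
      · have h1 : d i = 1 := by omega
        have h3 : lmax = lmin := by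
          rw [hlmax, hlmin]; congr 1; omega
        rw [hK, h3, div_self hminpos.ne', h1]
        norm_num
        exact hD1
    set s := √(K * ε ^ 2) with hs
    have hs2 : s ^ 2 = K * ε ^ 2 := Real.sq_sqrt (by positivity)
    have hospan : Submodule.span ℝ (o '' (clusterFinset d i : Set ℕ)) =
        Submodule.span ℝ (u '' (clusterFinset d i : Set ℕ)) := by
      rw [← clusterSpan_eq, ← clusterSpan_eq, ho.span_eq i hi]
    have hdist := dist_span_le_of_vecDist_le h ha hS hminpos hmin hmax
      (fun k hk j hj => ho.orthonormal k (hlt k hk) j (hlt j hj)) hospan hε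
      (fun k hk => hoy k (hlt k hk))
    rw [card_clusterFinset, ← hK, ← hs2] at hdist
    set σ := shift d w l i with hσ
    have hσζ := hζ i hi
    have hσ1 : lmin ≤ shift d w lam i := le_shift hw hi hmin
    have hσ2 : shift d w lam i ≤ lmax := shift_le hw hi hmax
    obtain ⟨hσa, hσb⟩ := abs_le.1 hσζ
    have hσpos : 0 < σ := by linarith
    obtain ⟨v, hv, hle⟩ := dist_span_le_of_shiftedInverse (η := η) (G := G) h hm ha hb hS
      (fun k hk => hy k (hlt k hk)) (fun k hk => hstep.half_mem k (hlt k hk)) hσpos.ne'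
      (fun k hk => by
        have h1 : |lam k - shift d w lam i| ≤ γ := abs_sub_shift_le hw hi fun j hj =>
          abs_sub_le_iff.2 ⟨sub_le_spread h hN hi hj hk, sub_le_spread h hN hi hk hj⟩
        have h2 := abs_sub_le (lam k) (shift d w lam i) σ
        linarith)
      hG (fun k hk hkS => by
        have hkm := Finset.mem_range.1 hk
        rw [mem_clusterFinset] at hkS
        rcases lt_or_ge k (start d i) with hk' | hk'
        · obtain ⟨i', hi', hki'⟩ := exists_mem_cluster d hk'
          have h1 : g ≤ lmin - lam k := gap_le_sub h hN (hi'.trans hi)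
            (mem_clusterFinset.1 hki').2 (start_mono d hi') ((hlt _ hfirst).trans hN)
          rw [abs_sub_comm]
          exact le_trans (by linarith) (le_abs_self _)
        · have h1 : g ≤ lam k - lmax := gap_le_sub h hN hi
            (mem_clusterFinset.1 hlast).2 (by omega) hkm
          exact le_trans (by linarith) (le_abs_self _))
      (fun k hk => (hreg i hi k (Finset.mem_range.1 hk)).symm)
      (fun k hk => hstep.source i hi k (by rw [← coe_clusterFinset]; exact hk))
      (by rw [hs2]; exact hKx) hdist e he
    refine ⟨v, Submodule.span_mono (Set.image_mono fun k hk => hlt k hk) hv,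
      hle.trans (mul_le_mul_of_nonneg_right ?_ (ha.nonneg e))⟩
    rw [hs2, hβ2]
    exact contraction_le hε2 hdi1 (by linarith) hK0 (by linarith) hKx hG hKcond
  have hall := dist_span_le_of_clusters h ha hN (Real.sqrt_nonneg _) hcluster
  refine IsInnerForm.subspaceDist_le (by positivity) fun e he => ?_
  obtain ⟨v, hv, hle⟩ := hall e he
  refine ⟨v, hv, (ha.energyNorm_le_mul_iff (by positivity)).2 (hle.trans (le_of_eq ?_))⟩
  congr 1
  rw [hβ2, div_pow, Real.sq_sqrt hden.le, mul_pow, mul_pow, Real.sq_sqrt (by positivity)]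
  ring

end Iteration

/-! ### The recursion for the error bounds -/

section Recursion

variable {C D N κ c g γ Λ : ℝ} {ε ζ : ℕ → ℝ}

/-- One step of the recursion for the error bounds keeps them small and halves the first one. -/
lemma errorBound_step {e z : ℝ} (hC : 1 ≤ C) (hD : 1 ≤ D) (hN : 1 ≤ N)
    (hg : 0 < g) (hΛ : 0 < Λ) (hgΛ : κ * Λ ≤ g) (hγc : γ ≤ c * g)
    (hc0 : 0 < c) (hc1 : c ≤ 1 / 8) (hc2 : c ≤ κ) (hc3 : D ^ 2 * c ≤ 1 / 4)
    (hc4 : 8 * C * √(D * N) * c ≤ 1)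
    (he : 0 < e) (hec : e ≤ c) (hzc : z ≤ c * g) (hγz : 0 < γ + z) {e' : ℝ}
    (he' : e' = C * √(D * N) * (γ + z) * e /
      √((g - γ - z) ^ 2 * (1 - D * e ^ 2) + D * (γ + z) ^ 2 * e ^ 2)) :
    0 < e' ∧ e' ≤ e / 2 ∧ 0 < Λ / C ^ 2 * e' ^ 2 ∧ Λ / C ^ 2 * e' ^ 2 ≤ c * g ∧
      D ^ 2 * e ^ 2 ≤ 1 / 4 ∧ 0 < g - γ - z := by
  have hcg : c * g ≤ 1 / 8 * g := mul_le_mul_of_nonneg_right hc1 hg.le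
  have hG : 3 / 4 * g ≤ g - γ - z := by linarith
  have he2 : e ^ 2 ≤ c := by nlinarith
  have hDe : D ^ 2 * e ^ 2 ≤ 1 / 4 :=
    (mul_le_mul_of_nonneg_left he2 (sq_nonneg D)).trans hc3
  have hDe1 : D * e ^ 2 ≤ 1 / 4 := by nlinarith [sq_nonneg e]
  have hden : (g / 2) ^ 2 ≤ (g - γ - z) ^ 2 * (1 - D * e ^ 2) + D * (γ + z) ^ 2 * e ^ 2 := by
    have h1 : (3 / 4 * g) ^ 2 * (3 / 4) ≤ (g - γ - z) ^ 2 * (1 - D * e ^ 2) := by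
      gcongr
      linarith
    have h2 : 0 ≤ D * (γ + z) ^ 2 * e ^ 2 := by positivity
    nlinarith [sq_nonneg g]
  have hsqrt := Real.le_sqrt_of_sq_le hden
  have hDN : 0 < √(D * N) := Real.sqrt_pos.2 (by positivity)
  have hpos : 0 < e' := by
    rw [he']
    exact div_pos (by positivity) (by linarith)
  have hle : e' ≤ e / 2 := by
    rw [he', div_le_iff₀ (by linarith)]
    have h1 : C * √(D * N) * (γ + z) * e ≤ C * √(D * N) * (2 * (c * g)) * e := by
      gcongr; linarith
    have h2 : 8 * C * √(D * N) * c * (g * e) ≤ 1 * (g * e) := by gcongr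
    have h3 : e / 2 * (g / 2) ≤ e / 2 *
        √((g - γ - z) ^ 2 * (1 - D * e ^ 2) + D * (γ + z) ^ 2 * e ^ 2) := by gcongr
    linarith
  refine ⟨hpos, hle, by positivity, ?_, hDe, by linarith⟩
  have h1 : Λ / C ^ 2 ≤ Λ := div_le_self hΛ.le (one_le_pow₀ hC)
  have h2 : e' ^ 2 ≤ c ^ 2 := pow_le_pow_left₀ hpos.le (by linarith) 2
  calc Λ / C ^ 2 * e' ^ 2 ≤ Λ * c ^ 2 := by gcongr
    _ ≤ Λ * (c * κ) := by rw [sq]; gcongr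
    _ = c * (κ * Λ) := by ring
    _ ≤ c * g := by gcongr

/-- The invariants of the recursion for the error bounds. -/
lemma errorBound_invariants (hC : 1 ≤ C) (hD : 1 ≤ D) (hN : 1 ≤ N)
    (hg : 0 < g) (hΛ : 0 < Λ) (hgΛ : κ * Λ ≤ g) (hγ : 0 ≤ γ) (hγc : γ ≤ c * g)
    (hc0 : 0 < c) (hc1 : c ≤ 1 / 8) (hc2 : c ≤ κ) (hc3 : D ^ 2 * c ≤ 1 / 4)
    (hc4 : 8 * C * √(D * N) * c ≤ 1)
    (he : 0 < ε 0) (hec : ε 0 ≤ c) (hz : 0 ≤ ζ 0) (hzc : ζ 0 ≤ c * g) (hγz : 0 < γ + ζ 0)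
    (hε : ∀ n, ε (n + 1) = C * √(D * N) * (γ + ζ n) * ε n /
      √((g - γ - ζ n) ^ 2 * (1 - D * ε n ^ 2) + D * (γ + ζ n) ^ 2 * ε n ^ 2))
    (hζ : ∀ n, ζ (n + 1) = Λ / C ^ 2 * ε (n + 1) ^ 2) (n : ℕ) :
    0 < ε n ∧ ε n ≤ c * (1 / 2) ^ n ∧ 0 ≤ ζ n ∧ ζ n ≤ c * g ∧ 0 < γ + ζ n := by
  induction n with
  | zero => exact ⟨he, by simpa using hec, hz, hzc, hγz⟩
  | succ n ih =>
    obtain ⟨h1, h2, h3, h4, h5⟩ := ih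
    have hle : c * (1 / 2) ^ n ≤ c :=
      mul_le_of_le_one_right hc0.le (pow_le_one₀ (by norm_num) (by norm_num))
    obtain ⟨k1, k2, k3, k4, -, -⟩ := errorBound_step hC hD hN hg hΛ hgΛ hγc hc0 hc1 hc2 hc3
      hc4 h1 (h2.trans hle) h4 h5 (hε n)
    rw [← hζ n] at k3 k4
    refine ⟨k1, ?_, k3.le, k4, by linarith⟩
    rw [pow_succ]; linarith

lemma tendsto_errorBound_ratio (hgγ : 0 < g - γ) (hpos : ∀ n, 0 < ε n)
    (hε0 : Tendsto ε atTop (𝓝 0)) (hζ0 : Tendsto ζ atTop (𝓝 0))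
    (hε : ∀ n, ε (n + 1) = C * √(D * N) * (γ + ζ n) * ε n /
      √((g - γ - ζ n) ^ 2 * (1 - D * ε n ^ 2) + D * (γ + ζ n) ^ 2 * ε n ^ 2)) :
    Tendsto (fun n => ε (n + 1) / ε n) atTop (𝓝 (C * √(D * N) * γ / (g - γ))) := by
  have h1 : ∀ n, ε (n + 1) / ε n = C * √(D * N) * (γ + ζ n) /
      √((g - γ - ζ n) ^ 2 * (1 - D * ε n ^ 2) + D * (γ + ζ n) ^ 2 * ε n ^ 2) := fun n => by
    rw [hε n]
    have := (hpos n).ne'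
    field_simp
  simp only [h1]
  have h2 : Tendsto (fun n => √((g - γ - ζ n) ^ 2 * (1 - D * ε n ^ 2) +
      D * (γ + ζ n) ^ 2 * ε n ^ 2)) atTop
      (𝓝 √((g - γ - 0) ^ 2 * (1 - D * 0 ^ 2) + D * (γ + 0) ^ 2 * 0 ^ 2)) :=
    ((((hζ0.const_sub _).pow 2).mul (((hε0.pow 2).const_mul D).const_sub 1)).add
      ((((hζ0.const_add γ).pow 2).const_mul D).mul (hε0.pow 2))).sqrt
  have h3 : √((g - γ - 0) ^ 2 * (1 - D * 0 ^ 2) + D * (γ + 0) ^ 2 * 0 ^ 2) = g - γ := by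
    conv_rhs => rw [← Real.sqrt_sq hgγ.le]
    congr 1; ring
  rw [h3] at h2
  have h4 := (hζ0.const_add γ).const_mul (C * √(D * N))
  rw [add_zero] at h4
  exact h4.div h2 hgγ.ne'

lemma tendsto_errorBound_cubic (hC : 0 < C) (hg : 0 < g) (hpos : ∀ n, 0 < ε n)
    (hε0 : Tendsto ε atTop (𝓝 0)) (hζ0 : Tendsto ζ atTop (𝓝 0)) (hγ : γ = 0)
    (hε : ∀ n, ε (n + 1) = C * √(D * N) * (γ + ζ n) * ε n /
      √((g - γ - ζ n) ^ 2 * (1 - D * ε n ^ 2) + D * (γ + ζ n) ^ 2 * ε n ^ 2))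
    (hζ : ∀ n, ζ (n + 1) = Λ / C ^ 2 * ε (n + 1) ^ 2) :
    Tendsto (fun n => ε (n + 1) / ε n ^ 3) atTop (𝓝 (√(D * N) * Λ / (g * C))) := by
  rw [← tendsto_add_atTop_iff_nat 1]
  have hε1 := (tendsto_add_atTop_iff_nat 1).2 hε0
  have hζ1 := (tendsto_add_atTop_iff_nat 1).2 hζ0
  have h1 : ∀ n, ε (n + 1 + 1) / ε (n + 1) ^ 3 = √(D * N) * Λ / C /
      √((g - ζ (n + 1)) ^ 2 * (1 - D * ε (n + 1) ^ 2) +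
        D * ζ (n + 1) ^ 2 * ε (n + 1) ^ 2) := fun n => by
    have h2 := (hpos (n + 1)).ne'
    rw [hε (n + 1), hγ, sub_zero, zero_add]
    conv_lhs => enter [1, 1, 1, 2]; rw [hζ n]
    field_simp
  simp only [h1]
  have h2 : Tendsto (fun n => √((g - ζ (n + 1)) ^ 2 * (1 - D * ε (n + 1) ^ 2) +
        D * ζ (n + 1) ^ 2 * ε (n + 1) ^ 2)) atTop
      (𝓝 √((g - 0) ^ 2 * (1 - D * 0 ^ 2) + D * 0 ^ 2 * 0 ^ 2)) :=
    ((((hζ1.const_sub _).pow 2).mul (((hε1.pow 2).const_mul D).const_sub 1)).add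
      (((hζ1.pow 2).const_mul D).mul (hε1.pow 2))).sqrt
  have h3 : √((g - 0) ^ 2 * (1 - D * 0 ^ 2) + D * 0 ^ 2 * 0 ^ 2) = g := by
    conv_rhs => rw [← Real.sqrt_sq hg.le]
    congr 1; ring
  rw [h3] at h2
  have h4 : √(D * N) * Λ / (g * C) = √(D * N) * Λ / C / g := by field_simp
  rw [h4]
  exact tendsto_const_nhds.div h2 hg.ne'

end Recursion

end ParO

/-! ### Convergence of the shifted-inverse algorithm -/

theorem mainTheorem1 (q : ℕ) (hq : 0 < q) (d : ℕ → ℕ) (hd : ∀ i < q, 0 < d i)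
    (κ : ℝ) (hκ : 0 < κ) :
    -- the constant depends only on the multiplicities and on `κ`
    ∃ C₀ : ℝ, 0 < C₀ ∧ ∀ C : ℝ, C₀ ≤ C →
    -- the smallness threshold depends only on the multiplicities, on `κ` and on `C`
    ∃ c : ℝ, 0 < c ∧
    ∀ (H : Type*) [NormedAddCommGroup H] [InnerProductSpace ℝ H] [CompleteSpace H]
      [TopologicalSpace.SeparableSpace H]
      (a b : H →ₗ[ℝ] H →ₗ[ℝ] ℝ) (_ : ParO.AdmissibleForms a b)
      (lamExact : ℕ → ℝ) (_ : ParO.SmallestEigenvalues a b q lamExact d)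
      (Vh : Submodule ℝ H) (m : ℕ) (_ : Module.finrank ℝ Vh = m) (_ : ParO.start d q < m)
      (lamh : ℕ → ℝ) (uh : ℕ → H) (_ : ParO.OrderedEigenpairs a b Vh m lamh uh)
      (g γ Λ D N : ℝ) (_ : g = ParO.gap q d lamh) (_ : γ = ParO.spread q d lamh)
      (_ : Λ = lamh (ParO.start d q)) (_ : D = ((Finset.range q).sup d : ℕ))
      (_ : N = (ParO.start d q : ℕ))
      (_ : κ * Λ ≤ g) (_ : κ * Λ ≤ lamh 0),
      ParO.ProjectionConstant a b Vh q d uh C c ∧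
      ∀ (w : ℕ → ℕ → ℝ) (_ : ParO.ConvexWeights q d w)
        (lam : ℕ → ℕ → ℝ) (u uhalf : ℕ → ℕ → H)
        (_ : ∀ k < ParO.start d q, u 0 k ∈ Vh)
        (_ : ParO.ShiftsRegular q d w m lamh (lam 0))
        (ε ζ : ℕ → ℝ)
        -- the smallness assumptions `0 < ε₀ ≪ 1`, `ζ₀ ≪ g`, `γ ≪ g`
        (_ : 0 < ε 0) (_ : ε 0 ≤ c)
        (_ : ζ 0 = ParO.shiftError q d w lamh (lam 0)) (_ : ζ 0 ≤ c * g) (_ : γ ≤ c * g)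
        (_ : ∃ o : ℕ → H, ParO.OrthonormalBases b q d uh o ∧
          ∀ k < ParO.start d q, ParO.vecDist a (o k) (u 0 k) ≤ ε 0)
        -- the recursions for the error bounds
        (_ : ∀ n, ε (n + 1) = C * √(D * N) * (γ + ζ n) * ε n /
          √((g - γ - ζ n) ^ 2 * (1 - D * ε n ^ 2) + D * (γ + ζ n) ^ 2 * ε n ^ 2))
        (_ : ∀ n, ζ (n + 1) = Λ / C ^ 2 * ε (n + 1) ^ 2),
        -- error bounds as long as the algorithm is run with shifts that are no eigenvalues
        (∀ n : ℕ,
          (∀ t ≤ n, ParO.ShiftsRegular q d w m lamh (lam t) ∧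
            ParO.ShiftedInverseStep a b Vh q d w (lam t) (u t) (uhalf t)
              (lam (t + 1)) (u (t + 1))) →
          (∃ o : ℕ → H, ParO.OrthonormalBases b q d uh o ∧
            ∀ k < ParO.start d q, ParO.vecDist a (o k) (u (n + 1) k) ≤ ε (n + 1)) ∧
          ∀ k < ParO.start d q, |lamh k - lam (n + 1) k| ≤ ζ (n + 1)) ∧
        (∀ n, 0 < ε n) ∧ Tendsto ε atTop (𝓝 0) ∧
        Tendsto (fun n => ε (n + 1) / ε n) atTop (𝓝 (C * √(D * N) * γ / (g - γ))) ∧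
        (γ = 0 →
          Tendsto (fun n => ε (n + 1) / ε n ^ 3) atTop (𝓝 (√(D * N) * Λ / (g * C)))) := by
  set N₀ := ParO.start d q with hN₀
  set D₀ : ℝ := (((Finset.range q).sup d : ℕ) : ℝ) with hD₀
  have hdD : ∀ i < q, (d i : ℝ) ≤ D₀ := fun i hi =>
    Nat.cast_le.2 (Finset.le_sup (f := d) (Finset.mem_range.2 hi))
  have hD1 : 1 ≤ D₀ := le_trans (by exact_mod_cast hd 0 hq) (hdD 0 hq)
  have hN0 : 0 < N₀ := lt_of_lt_of_le (by rw [ParO.start_succ]; have := hd 0 hq; omega)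
    (ParO.start_mono d (show 0 + 1 ≤ q from hq))
  have hN1 : (1 : ℝ) ≤ (N₀ : ℝ) := by exact_mod_cast hN0
  refine ⟨max 1 (ParO.projConst N₀ κ), lt_max_of_lt_left one_pos, fun C hC => ?_⟩
  have hC1 : 1 ≤ C := (le_max_left _ _).trans hC
  have hCP : ParO.projConst N₀ κ ≤ C := (le_max_right _ _).trans hC
  set A := ParO.gramSchmidtConst N₀ * √(ParO.leakConst N₀ κ / κ) with hA
  have hA0 : 0 ≤ A := mul_nonneg (zero_le_one.trans (ParO.one_le_gramSchmidtConst N₀))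
    (Real.sqrt_nonneg _)
  -- each summand of `T` is one smallness requirement on `c = 1 / T`
  set T := 8 + 4 / κ + A + 4 * D₀ ^ 2 + 8 * C * √(D₀ * N₀) with hT
  have hκ4 : 0 < 4 / κ := by positivity
  have hCD : 0 ≤ 8 * C * √(D₀ * N₀) := by positivity
  have hDD : 0 ≤ 4 * D₀ ^ 2 := by positivity
  have hTpos : 0 < T := by linarith
  obtain ⟨c, hc⟩ : ∃ c, c = 1 / T := ⟨_, rfl⟩
  have hc0 : 0 < c := by rw [hc]; positivity
  have hcT : ∀ P, P ≤ T → P * c ≤ 1 := fun P hP => by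
    rw [hc, mul_one_div, div_le_one hTpos]; exact hP
  have hc8 : c ≤ 1 / 8 := by have := hcT 8 (by linarith); linarith
  have hcκ : c ≤ κ / 4 := by
    have := hcT (4 / κ) (by linarith)
    rw [div_mul_eq_mul_div, div_le_one hκ] at this
    linarith
  have hcA : A * c ≤ 1 := hcT A (by linarith)
  have hcD : D₀ ^ 2 * c ≤ 1 / 4 := by have := hcT (4 * D₀ ^ 2) (by linarith); linarith
  have hcC : 8 * C * √(D₀ * N₀) * c ≤ 1 := hcT _ (by linarith)
  have hc2 : c ^ 2 ≤ c := by nlinarith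
  refine ⟨c, hc0, ?_⟩
  intro H _ _ _ _ a b hab lamExact _ Vh m hm hNm lamh uh h g γ Λ D N hg hγ hΛ hD hN hgap hlow
  rw [hΛ] at hgap hlow
  rw [hg] at hgap
  have hD' : D = D₀ := hD
  have hN' : N = N₀ := hN
  subst hD' hN'
  have ha := hab.isInnerForm_left
  have hb := hab.isInnerForm_right
  have : FiniteDimensional ℝ Vh := Module.finite_of_finrank_pos (by omega)
  have hΛ0 : 0 < lamh N₀ := h.pos ha hNm
  have hgpos : 0 < ParO.gap q d lamh := lt_of_lt_of_le (mul_pos hκ hΛ0) hgap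
  have hPC : ParO.ProjectionConstant a b Vh q d uh C c :=
    ParO.projectionConstant h hm ha hb hNm hκ hgap hlow hCP (by linarith) (by linarith)
      (by rw [← mul_assoc]; exact hcA)
  refine ⟨hPC, ?_⟩
  intro w hw lam u uhalf hu0 hreg0 ε ζ hε0 hε0c hζ0 hζ0c hγc hinit hε hζ
  rw [← hΛ] at hΛ0 hgap
  have hγ0 : 0 ≤ γ := hγ ▸ ParO.spread_nonneg h hq hd hNm
  rw [← hg] at hgap hgpos
  have hζinit : ∀ i < q, |ParO.shift d w lamh i - ParO.shift d w (lam 0) i| ≤ ζ 0 := fun i hi => by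
    rw [hζ0]; exact ParO.abs_shift_sub_shift_le_shiftError hi
  have hζ0nn : 0 ≤ ζ 0 := (abs_nonneg _).trans (hζinit 0 hq)
  -- if `γ = ζ₀ = 0`, then the first shift is the eigenvalue of a degenerate cluster
  have hγζ : 0 < γ + ζ 0 := by
    by_contra hcon
    have hγz : γ = 0 := by linarith
    have hζz : ζ 0 = 0 := by linarith
    have hmem : 0 ∈ ParO.clusterFinset d 0 := ParO.mem_clusterFinset.2
      ⟨by simp [ParO.start], by rw [ParO.start_succ]; have := hd 0 hq; omega⟩
    have h1 := hζinit 0 hq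
    rw [hζz] at h1
    have h2 : |lamh 0 - ParO.shift d w lamh 0| ≤ 0 := ParO.abs_sub_shift_le hw hq fun k hk => by
      rw [← hγz, hγ]
      exact abs_sub_le_iff.2 ⟨ParO.sub_le_spread h hNm hq hk hmem,
        ParO.sub_le_spread h hNm hq hmem hk⟩
    have h3 := abs_sub_le (lamh 0) (ParO.shift d w lamh 0) (ParO.shift d w (lam 0) 0)
    have h4 := abs_nonpos_iff.1 (h3.trans (by linarith))
    exact hreg0 0 hq 0 (by omega) (sub_eq_zero.1 h4).symm
  have hinv := ParO.errorBound_invariants hC1 hD1 hN1 hgpos hΛ0 hgap hγ0 hγc hc0 hc8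
    (by linarith) hcD hcC hε0 hε0c hζ0nn hζ0c hγζ hε hζ
  have hpos : ∀ n, 0 < ε n := fun n => (hinv n).1
  have hle : ∀ n, ε n ≤ c := fun n => (hinv n).2.1.trans
    (mul_le_of_le_one_right hc0.le (pow_le_one₀ (by norm_num) (by norm_num)))
  have hεlim : Tendsto ε atTop (𝓝 0) := by
    have h1 : Tendsto (fun n : ℕ => c * (1 / 2 : ℝ) ^ n) atTop (𝓝 (c * 0)) :=
      (tendsto_pow_atTop_nhds_zero_of_lt_one (by norm_num) (by norm_num)).const_mul c
    rw [mul_zero] at h1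
    exact squeeze_zero (fun n => (hpos n).le) (fun n => (hinv n).2.1) h1
  have hζlim : Tendsto ζ atTop (𝓝 0) := by
    rw [← tendsto_add_atTop_iff_nat 1]
    simp only [hζ]
    have h1 := (((tendsto_add_atTop_iff_nat 1).2 hεlim).pow 2).const_mul (Λ / C ^ 2)
    simpa using h1
  have hgγ : 0 < g - γ := by nlinarith
  have hΛ' : lamh N₀ = Λ := hΛ.symm
  have hlam0 : γ ≤ lamh 0 / 4 ∧ c * g < lamh 0 := by
    have h1 : g ≤ Λ := by
      have h2 := ParO.gap_le_top_sub h hNm hN0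
      rw [← hg, ← hΛ] at h2
      linarith [h.pos ha (show 0 < m by omega)]
    have h3 : c * g ≤ κ / 4 * Λ := by gcongr
    have h4 := h.pos ha (show 0 < m by omega)
    rw [hΛ'] at hlow
    constructor <;> linarith
  -- the bounds pass from one iterate to the next, with the bases supplied by the projected problem
  have hone : ∀ n, ParO.ShiftsRegular q d w m lamh (lam n) →
      ParO.ShiftedInverseStep a b Vh q d w (lam n) (u n) (uhalf n) (lam (n + 1)) (u (n + 1)) →
      (∀ k < N₀, u n k ∈ Vh) →
      (∀ i < q, |ParO.shift d w lamh i - ParO.shift d w (lam n) i| ≤ ζ n) →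
      (∃ o : ℕ → H, ParO.OrthonormalBases b q d uh o ∧
        ∀ k < N₀, ParO.vecDist a (o k) (u n k) ≤ ε n) →
      (∀ k < N₀, u (n + 1) k ∈ Vh) ∧
      (∃ o : ℕ → H, ParO.OrthonormalBases b q d uh o ∧
        ∀ k < N₀, ParO.vecDist a (o k) (u (n + 1) k) ≤ ε (n + 1)) ∧
      ∀ k < N₀, |lamh k - lam (n + 1) k| ≤ ζ (n + 1) := by
    intro n hreg hstep hmem hshift ⟨o, ho, hou⟩
    obtain ⟨i1, -, i3, i4, i5⟩ := hinv n
    obtain ⟨-, s2, -, -, s5, s6⟩ := ParO.errorBound_step hC1 hD1 hN1 hgpos hΛ0 hgap hγc hc0 hc8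
      (by linarith) hcD hcC i1 (hle n) i4 i5 (hε n)
    have hdist := ParO.subspaceDist_shiftedInverse_le h hm ha hb hq hd hNm hw hdD hmem hreg hstep
      hshift ho i1.le hou s5 (by rw [← hγ]; exact hlam0.1) (i4.trans_lt hlam0.2)
      (by rw [← hg, ← hγ]; exact s6)
    rw [← hg, ← hγ] at hdist
    set U := Submodule.span ℝ (uhalf n '' Set.Iio N₀) with hU
    have hεC : ε (n + 1) / C = √(D₀ * N₀) * (γ + ζ n) * ε n /
        √((g - γ - ζ n) ^ 2 * (1 - D₀ * ε n ^ 2) + D₀ * (γ + ζ n) ^ 2 * ε n ^ 2) := by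
      rw [hε n]; field_simp
    rw [← hεC] at hdist
    set δ := ParO.subspaceDist a (Submodule.span ℝ (uh '' (Finset.range N₀ : Set ℕ))) U with hδ
    have hδ0 : 0 ≤ δ := ParO.IsInnerForm.subspaceDist_nonneg _ _ _
    have hCpos : 0 < C := by linarith
    have hδc : δ ≤ c := by
      refine hdist.trans ((div_le_self (hpos _).le hC1).trans ?_)
      exact hle (n + 1)
    have hδ2 : δ ^ 2 ≤ c ^ 2 := pow_le_pow_left₀ hδ0 hδc 2
    have hUV : U ≤ Vh := by
      rw [hU, Submodule.span_le]
      rintro _ ⟨k, hk, rfl⟩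
      exact hstep.half_mem k hk
    have : FiniteDimensional ℝ U := Submodule.finiteDimensional_of_le hUV
    have hfin : Module.finrank ℝ U = N₀ := by
      apply le_antisymm
      · classical
        rw [hU, ← Finset.coe_range, ← Finset.coe_image]
        exact (finrank_span_finset_le_card _).trans
          (Finset.card_image_le.trans (Finset.card_range _).le)
      · have h1 := hstep.projected.orthonormalFamily.finrank_span
        rw [Finset.card_range] at h1
        calc N₀ = _ := h1.symm
          _ ≤ _ := Submodule.finrank_mono (hstep.projected.span_le subset_rfl)
    refine ⟨fun k hk => hUV (hstep.projected.mem k hk), ?_, fun k hk => ?_⟩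
    · obtain ⟨o', ho', hou'⟩ := hPC U (lam (n + 1)) (u (n + 1)) hUV hfin hstep.projected
        (by rw [← Finset.coe_range]; exact hδc)
      refine ⟨o', ho', fun k hk => (hou' k hk).trans ?_⟩
      rw [← Finset.coe_range]
      rwa [le_div_iff₀' hCpos] at hdist
    · obtain ⟨r1, -, r3⟩ := ParO.ritzValue_bounds h hm ha hb hNm (κ := κ)
        (by rw [← hg, hΛ']; exact hgap) hUV hfin hstep.projected (δ := δ) (by linarith)
        (by linarith) (fun e he => by
          obtain ⟨v, hv, hve⟩ := ha.exists_energyNorm_sub_le (V := U) he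
          exact ⟨v, hv, (ha.energyNorm_le_mul_iff hδ0).1 hve⟩) hk
      rw [abs_sub_comm, abs_of_nonneg (by linarith), hζ n]
      refine r3.trans ?_
      rw [hΛ', div_mul_eq_mul_div, mul_div_assoc, ← div_pow]
      gcongr
  refine ⟨fun n hsteps => ?_, hpos, hεlim,
    ParO.tendsto_errorBound_ratio hgγ hpos hεlim hζlim hε,
    fun hγz => ParO.tendsto_errorBound_cubic (by linarith) hgpos hpos hεlim hζlim hγz hε hζ⟩
  have hall : ∀ t ≤ n, (∀ k < N₀, u t k ∈ Vh) ∧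
      (∀ i < q, |ParO.shift d w lamh i - ParO.shift d w (lam t) i| ≤ ζ t) ∧
      ∃ o : ℕ → H, ParO.OrthonormalBases b q d uh o ∧
        ∀ k < N₀, ParO.vecDist a (o k) (u t k) ≤ ε t := by
    intro t
    induction t with
    | zero => exact fun _ => ⟨hu0, hζinit, hinit⟩
    | succ t ih =>
      intro ht
      obtain ⟨j1, j2, j3⟩ := ih (by omega)
      obtain ⟨k1, k2, k3⟩ := hone t (hsteps t (by omega)).1 (hsteps t (by omega)).2 j1 j2 j3
      exact ⟨k1, fun i hi => ParO.abs_shift_sub_shift_le hw hi fun k hk =>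
        k3 k (Finset.mem_range.1 (ParO.clusterFinset_subset hi hk)), k2⟩
  obtain ⟨j1, j2, j3⟩ := hall n le_rfl
  exact (hone n (hsteps n le_rfl).1 (hsteps n le_rfl).2 j1 j2 j3).2
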